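/- Let $k\ge 2$ and let $R_k=\mathbb{C}[x,y]/(x^k)$ be $\mathbb{Z}$-graded with $\deg x=1$, $\deg y=-1$. Let $\mathrm{MCM}_{\mathbb{Z}}R_k$ be the exact category of finitely generated $\mathbb{Z}$-graded maximal Cohen–Macaulay $R_k$-modules, with degree-preserving $R_k$-linear maps, and let $\mathrm{Ext}^1$ denote the group of equivalence classes of short exact sequences in this category. Put $\mathcal F=\mathbb{C}[x,y^{\pm1}]/(x^k)$, graded in the same way; a finitely generated graded $R_k$-module $M$ is called generically free of rank $1$ if $M\otimes_{R_k}\mathcal F$ is a graded free $\mathcal F$-module of rank $1$. For a $k$-subset $\underline\ell=\{\ell_1<\dots<\ell_k\}$ of $\mathbb{Z}$ let $$I(\underline\ell)=\big(x^{k-1},\,x^{k-2}y^{i_1},\,\dots,\,x\,y^{i_{k-2}},\,y^{i_{k-1}}\big)(i_k),\qquad i_{k-p}=\ell_k-\ell_p-(k-p)\ (1\le p\le k-1),\quad i_k=k-1-\ell_k,$$ a graded ideal of $R_k$ shifted by $i_k$, where $M(j)_d=M_{d+j}$. Two $k$-subsets $\underline\ell,\underline m$ of $\mathbb{Z}$ cross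 if there are $a_1,a_2\in\underline\ell\setminus\underline m$ and $b_1,b_2\in\underline m\setminus\underline\ell$ with $a_1<b_1<a_2<b_2$ or $b_1<a_1<b_2<a_2$, and are noncrossing otherwise; the Plücker coordinates $p_{\underline\ell}$ and $p_{\underline m}$ are called compatible if $\underline\ell$ and $\underline m$ are noncrossing. **Theorem.** Let $I,J$ be generically free modules of rank $1$ in $\mathrm{MCM}_{\mathbb{Z}}R_k$. Then there are unique $k$-subsets $\underline\ell(I)$ and $\underline\ell(J)$ of $\mathbb{Z}$ such that $I\cong I(\underline\ell(I))$ and $J\cong I(\underline\ell(J))$ as graded modules, and $\mathrm{Ext}^1(I,J)=0$ if and only if the Plücker coordinates $p_{\underline\ell(I)}$ and $p_{\underline\ell(J)}$ are compatible, i.e. if and only if the $k$-subsets $\underline\ell(I)$ and $\underline\ell(J)$ are noncrossing. -/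

import Mathlib

open scoped TensorProduct

universe u v w

noncomputable section

namespace GrassmannianInf

/-! ### The graded ring `R_k = ℂ[x, y] / (x ^ k)` -/

/-- The polynomial ring `ℂ[x, y]`. -/
abbrev Poly : Type := MvPolynomial (Fin 2) ℂ

/-- The weights of the variables: `x = X 0` has degree `1`, `y = X 1` has degree `-1`. -/
def weight : Fin 2 → ℤ := ![1, -1]

/-- The homogeneous polynomials of degree `d`. -/
abbrev polyPiece (d : ℤ) : Submodule ℂ Poly :=
  MvPolynomial.weightedHomogeneousSubmodule ℂ weight d

/-- The ideal `(x ^ k)` of `ℂ[x, y]`. -/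
def relIdeal (k : ℕ) : Ideal Poly := Ideal.span {(MvPolynomial.X 0 : Poly) ^ k}

/-- The ring `R_k = ℂ[x, y] / (x ^ k)`. -/
abbrev R (k : ℕ) : Type := Poly ⧸ relIdeal k

/-- The quotient map `ℂ[x, y] → R_k`. -/
abbrev toR (k : ℕ) : Poly →ₐ[ℂ] R k := Ideal.Quotient.mkₐ ℂ (relIdeal k)

/-- The class of `x` in `R_k`. -/
def xR (k : ℕ) : R k := toR k (MvPolynomial.X 0)

/-- The class of `y` in `R_k`. -/
def yR (k : ℕ) : R k := toR k (MvPolynomial.X 1)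

/-- The homogeneous part of degree `d` of `R_k`, where `x` has degree `1` and `y` degree `-1`. -/
def piece (k : ℕ) (d : ℤ) : Submodule ℂ (R k) := (polyPiece d).map (toR k).toLinearMap

theorem toR_mem_piece {k : ℕ} {d : ℤ} {f : Poly} (hf : f ∈ polyPiece d) : toR k f ∈ piece k d :=
  Submodule.mem_map_of_mem hf

theorem xR_mem (k : ℕ) : xR k ∈ piece k 1 :=
  toR_mem_piece (by simpa [weight] using MvPolynomial.isWeightedHomogeneous_X ℂ weight (0 : Fin 2))

theorem yR_mem (k : ℕ) : yR k ∈ piece k (-1) :=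
  toR_mem_piece (by simpa [weight] using MvPolynomial.isWeightedHomogeneous_X ℂ weight (1 : Fin 2))

instance piece_gradedMonoid (k : ℕ) : SetLike.GradedMonoid (piece k) where
  one_mem := by
    rw [← map_one (toR k)]
    exact toR_mem_piece (MvPolynomial.isWeightedHomogeneous_one ℂ weight)
  mul_mem := by
    rintro i j _ _ ⟨f, hf, rfl⟩ ⟨g, hg, rfl⟩
    have := toR_mem_piece (k := k) (MvPolynomial.IsWeightedHomogeneous.mul hf hg)
    rw [map_mul] at this
    exact this

/-- The weighted homogeneous components of a multiple of `x ^ k` are multiples of `x ^ k`. -/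
theorem component_mem_relIdeal (k : ℕ) (d : ℤ) {f : Poly} (hf : f ∈ relIdeal k) :
    MvPolynomial.weightedHomogeneousComponent weight d f ∈ relIdeal k := by
  classical
  rw [relIdeal, Ideal.mem_span_singleton, MvPolynomial.X_pow_eq_monomial,
    MvPolynomial.monomial_one_dvd_iff_modMonomial_eq_zero] at hf ⊢
  ext m
  rw [MvPolynomial.coeff_zero]
  by_cases hm : Finsupp.single 0 k ≤ m
  · exact MvPolynomial.coeff_modMonomial_of_le _ hm
  · have h0 : MvPolynomial.coeff m f = 0 := by
      rw [← MvPolynomial.coeff_modMonomial_of_not_le f hm, hf, MvPolynomial.coeff_zero]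
    rw [MvPolynomial.coeff_modMonomial_of_not_le _ hm,
      MvPolynomial.coeff_weightedHomogeneousComponent, h0, ite_self]

/-- `R_k` is the direct sum of its homogeneous parts. -/
theorem piece_isInternal (k : ℕ) : DirectSum.IsInternal (piece k) := by
  classical
  refine ⟨?_, ?_⟩
  · rw [injective_iff_map_eq_zero]
    intro a ha
    have hl : ∀ i, ∃ f ∈ polyPiece i, toR k f = (a i : R k) := fun i => (a i).2
    choose f hf hfa using hl
    rw [DirectSum.coeAddMonoidHom_eq_dfinsuppSum, DFinsupp.sum] at ha
    have h1 : (∑ i ∈ a.support, f i) ∈ relIdeal k := by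
      rw [← Ideal.Quotient.eq_zero_iff_mem]
      change toR k _ = 0
      rw [map_sum, ← ha]
      exact Finset.sum_congr rfl fun i _ => hfa i
    ext i
    by_cases hi : i ∈ a.support
    · have h2 := component_mem_relIdeal k i h1
      rw [map_sum, Finset.sum_eq_single i] at h2
      · rw [MvPolynomial.weightedHomogeneousComponent_of_mem (hf i), if_pos rfl,
          ← Ideal.Quotient.eq_zero_iff_mem] at h2
        have : toR k (f i) = 0 := h2
        rw [← hfa i, this]; rfl
      · intro j _ hj
        rw [MvPolynomial.weightedHomogeneousComponent_of_mem (hf j), if_neg (Ne.symm hj)]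
      · exact fun h => absurd hi h
    · rw [DFinsupp.notMem_support_iff] at hi
      rw [hi]; rfl
  · intro r
    obtain ⟨f, rfl⟩ := Ideal.Quotient.mk_surjective r
    have hs := MvPolynomial.sum_weightedHomogeneousComponent weight f
    have key : ∀ g ∈ Set.range fun d => MvPolynomial.weightedHomogeneousComponent weight d f,
        toR k g ∈ AddMonoidHom.mrange (DirectSum.coeAddMonoidHom (piece k)) := by
      rintro _ ⟨d, rfl⟩
      refine ⟨DirectSum.of (fun i => piece k i) d ⟨_, toR_mem_piece
        (MvPolynomial.weightedHomogeneousComponent_mem weight f d)⟩, ?_⟩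
      rw [DirectSum.coeAddMonoidHom_of]
    change toR k f ∈ AddMonoidHom.mrange (DirectSum.coeAddMonoidHom (piece k))
    rw [← hs, finsum_eq_sum _ (MvPolynomial.weightedHomogeneousComponent_finsupp f), map_sum]
    exact sum_mem fun d _ => key _ ⟨d, rfl⟩

/-- `R_k` is a `ℤ`-graded ring. -/
instance piece_gradedRing (k : ℕ) : GradedRing (piece k) where
  toDecomposition := (piece_isInternal k).chooseDecomposition

/-! ### Finitely generated graded modules -/

/-- An elementwise criterion for an internal direct sum decomposition of an abelian group. -/
theorem isInternal_iff {M : Type u} {σ : Type v} [AddCommGroup M] [SetLike σ M]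
    [AddSubgroupClass σ M] (A : ℤ → σ) :
    DirectSum.IsInternal A ↔
      (∀ (s : Finset ℤ) (f : ℤ → M), (∀ i, f i ∈ A i) → ∑ i ∈ s, f i = 0 → ∀ i ∈ s, f i = 0) ∧
      ∀ m : M, ∃ (s : Finset ℤ) (f : ℤ → M), (∀ i, f i ∈ A i) ∧ ∑ i ∈ s, f i = m := by
  classical
  constructor
  · rintro ⟨h1, h2⟩
    refine ⟨fun s f hf h0 i hi => ?_, fun m => ?_⟩
    · have h3 : DirectSum.coeAddMonoidHom A
          (∑ j ∈ s, DirectSum.of (fun j => A j) j ⟨f j, hf j⟩) = 0 := by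
        rw [map_sum, ← h0]
        exact Finset.sum_congr rfl fun j _ => DirectSum.coeAddMonoidHom_of A j _
      have h4 := (injective_iff_map_eq_zero _).1 h1 _ h3
      have h5 : (∑ j ∈ s, DirectSum.of (fun j => A j) j ⟨f j, hf j⟩) i = 0 := by
        rw [h4]; rfl
      rw [DFinsupp.finsetSum_apply, Finset.sum_eq_single i, DirectSum.of_eq_same] at h5
      · exact congrArg (fun a : A i => (a : M)) h5
      · intro j _ hj
        exact DirectSum.of_eq_of_ne _ _ _ hj.symm
      · exact fun h => absurd hi h
    · obtain ⟨a, rfl⟩ := h2 m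
      refine ⟨a.support, fun i => a i, fun i => (a i).2, ?_⟩
      rw [DirectSum.coeAddMonoidHom_eq_dfinsuppSum, DFinsupp.sum]
  · rintro ⟨h1, h2⟩
    refine ⟨(injective_iff_map_eq_zero _).2 fun a ha => ?_, fun m => ?_⟩
    · rw [DirectSum.coeAddMonoidHom_eq_dfinsuppSum, DFinsupp.sum] at ha
      ext i
      by_cases hi : i ∈ a.support
      · exact h1 a.support (fun i => a i) (fun i => (a i).2) ha i hi
      · rw [DFinsupp.notMem_support_iff] at hi
        rw [hi]; rfl
    · obtain ⟨s, f, hf, rfl⟩ := h2 m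
      refine ⟨∑ j ∈ s, DirectSum.of (fun j => A j) j ⟨f j, hf j⟩, ?_⟩
      rw [map_sum]
      exact Finset.sum_congr rfl fun j _ => DirectSum.coeAddMonoidHom_of A j _

/-- A finitely generated `ℤ`-graded `R_k`-module: an object of `gr R_k`. -/
structure GrMod (k : ℕ) where
  /-- The underlying `R_k`-module. -/
  carrier : Type u
  [addCommGroup : AddCommGroup carrier]
  [module : Module (R k) carrier]
  /-- The homogeneous elements of degree `d`. -/
  deg : ℤ → AddSubgroup carrier
  isInternal : DirectSum.IsInternal deg
  smul_mem : ∀ {i j : ℤ} {r : R k} {m : carrier}, r ∈ piece k i → m ∈ deg j → r • m ∈ deg (i + j)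
  finite : Module.Finite (R k) carrier

attribute [instance] GrMod.addCommGroup GrMod.module GrMod.finite

/-- The morphisms of `gr R_k`: the `R_k`-linear maps that preserve degrees. -/
structure GrHom {k : ℕ} (M : GrMod.{u} k) (N : GrMod.{v} k) where
  /-- The underlying linear map. -/
  toLin : M.carrier →ₗ[R k] N.carrier
  map_deg : ∀ {d : ℤ} {m : M.carrier}, m ∈ M.deg d → toLin m ∈ N.deg d

/-- The isomorphisms of `gr R_k`. -/
structure GrIso {k : ℕ} (M : GrMod.{u} k) (N : GrMod.{v} k) where
  /-- The underlying linear equivalence. -/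
  toEquiv : M.carrier ≃ₗ[R k] N.carrier
  map_deg_iff : ∀ {d : ℤ} {m : M.carrier}, toEquiv m ∈ N.deg d ↔ m ∈ M.deg d

namespace GrIso

/-- The identity isomorphism. -/
def refl {k : ℕ} (M : GrMod.{u} k) : GrIso M M := ⟨LinearEquiv.refl _ _, Iff.rfl⟩

/-- The inverse isomorphism. -/
def symm {k : ℕ} {M : GrMod.{u} k} {N : GrMod.{v} k} (e : GrIso M N) : GrIso N M :=
  ⟨e.toEquiv.symm, fun {d m} => by rw [← e.map_deg_iff, LinearEquiv.apply_symm_apply]⟩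

/-- The composition of isomorphisms. -/
def trans {k : ℕ} {M : GrMod.{u} k} {N : GrMod.{v} k} {P : GrMod.{w} k}
    (e : GrIso M N) (f : GrIso N P) : GrIso M P :=
  ⟨e.toEquiv.trans f.toEquiv, fun {d m} => by
    rw [LinearEquiv.trans_apply, f.map_deg_iff, e.map_deg_iff]⟩

end GrIso

/-- The shifted module `M(n)`, with `M(n)_d = M_{d + n}`. -/
def GrMod.shift {k : ℕ} (M : GrMod.{u} k) (n : ℤ) : GrMod.{u} k where
  carrier := M.carrier
  deg d := M.deg (d + n)
  isInternal := by
    classical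
    obtain ⟨h1, h2⟩ := (isInternal_iff M.deg).1 M.isInternal
    refine (isInternal_iff _).2 ⟨fun s f hf h0 i hi => ?_, fun m => ?_⟩
    · have h3 := h1 (s.map (Equiv.addRight n).toEmbedding) (fun j => f (j - n))
        (fun j => by simpa using hf (j - n)) (by simpa [Finset.sum_map] using h0) (i + n)
        (by simpa using hi)
      simpa using h3
    · obtain ⟨s, f, hf, rfl⟩ := h2 m
      exact ⟨s.map (Equiv.subRight n).toEmbedding, fun j => f (j + n), fun j => hf _,
        by simp [Finset.sum_map]⟩
  smul_mem {i j r m} hr hm := by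
    rw [add_assoc]
    exact M.smul_mem hr hm
  finite := M.finite

/-- A homogeneous ideal of `R_k`, as a graded module. -/
def GrMod.ofIdeal (k : ℕ) (I : Ideal (R k)) (hI : I.IsHomogeneous (piece k)) : GrMod.{0} k where
  carrier := I
  deg d := (piece k d).toAddSubgroup.comap I.subtype.toAddMonoidHom
  isInternal := by
    classical
    obtain ⟨h1, -⟩ := (isInternal_iff (piece k)).1 (piece_isInternal k)
    refine (isInternal_iff _).2 ⟨fun s f hf h0 i hi => ?_, fun m => ?_⟩
    · refine Subtype.ext (h1 s (fun j => (f j : R k)) hf ?_ i hi)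
      simpa using congrArg (fun a : I => (a : R k)) h0
    · refine ⟨(DirectSum.decompose (piece k) (m : R k)).support,
        fun i => ⟨DirectSum.decompose (piece k) (m : R k) i, hI i m.2⟩, fun i => ?_, ?_⟩
      · exact (DirectSum.decompose (piece k) (m : R k) i).2
      · refine Subtype.ext ?_
        simpa using DirectSum.sum_support_decompose (piece k) (m : R k)
  smul_mem {i j r m} hr hm := SetLike.GradedMul.mul_mem hr hm
  finite := inferInstance

/-! ### Maximal Cohen--Macaulay modules -/

/-- The depth of a (nonzero, finitely generated) module over a Noetherian local ring: the supremum
of the lengths of the regular sequences in the maximal ideal. -/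
def localDepth (A : Type v) (M : Type u) [CommRing A] [IsLocalRing A] [AddCommGroup M]
    [Module A M] : ℕ∞ :=
  ⨆ (rs : List A) (_ : (∀ r ∈ rs, r ∈ IsLocalRing.maximalIdeal A) ∧
    RingTheory.Sequence.IsRegular M rs), (rs.length : ℕ∞)

/-- A finitely generated module `M` over a commutative ring `A` is maximal Cohen--Macaulay if
`depth M_𝔭 = dim A_𝔭` for all primes `𝔭`. As usual, the zero module over a local ring
(whose depth is `∞` by convention) is admitted. -/
def IsMaximalCohenMacaulay (A : Type v) (M : Type u) [CommRing A] [AddCommGroup M]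
    [Module A M] : Prop :=
  Module.Finite A M ∧ ∀ (𝔭 : Ideal A) [𝔭.IsPrime],
    Subsingleton (LocalizedModule 𝔭.primeCompl M) ∨
      (localDepth (Localization.AtPrime 𝔭) (LocalizedModule 𝔭.primeCompl M) : WithBot ℕ∞) =
        ringKrullDim (Localization.AtPrime 𝔭)

/-- The objects of `MCM_ℤ R_k`. -/
def GrMod.IsMCM {k : ℕ} (M : GrMod.{u} k) : Prop := IsMaximalCohenMacaulay (R k) M.carrier

/-! ### Generically free modules -/

/-- The graded total ring of fractions `ℱ = (R_k)_y = ℂ[x, y, y⁻¹] / (x ^ k)`. -/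
abbrev F (k : ℕ) : Type := Localization.Away (yR k)

/-- The homogeneous elements of degree `d` of `ℱ`: the fractions `r / y ^ n` with
`deg r - deg (y ^ n) = deg r + n = d`. -/
def F.IsHomogeneous {k : ℕ} (d : ℤ) (f : F k) : Prop :=
  ∃ (n : ℕ) (r : R k), r ∈ piece k (d - n) ∧
    f * algebraMap (R k) (F k) (yR k) ^ n = algebraMap (R k) (F k) r

/-- The homogeneous part of degree `d` of `ℱ ⊗ M`, generated by the `f ⊗ m` with
`deg f + deg m = d`. -/
def GrMod.genericDeg {k : ℕ} (M : GrMod.{u} k) (d : ℤ) : AddSubgroup (F k ⊗[R k] M.carrier) :=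
  AddSubgroup.closure {z | ∃ (i j : ℤ) (f : F k) (m : M.carrier),
    i + j = d ∧ F.IsHomogeneous i f ∧ m ∈ M.deg j ∧ z = f ⊗ₜ[R k] m}

/-- `M` is generically free of rank `n`: `ℱ ⊗ M` is a graded free `ℱ`-module of rank `n`, i.e. it
has a basis consisting of `n` homogeneous elements. -/
def GrMod.IsGenericallyFree {k : ℕ} (M : GrMod.{u} k) (n : ℕ) : Prop :=
  ∃ b : Module.Basis (Fin n) (F k) (F k ⊗[R k] M.carrier), ∀ i, ∃ d : ℤ, b i ∈ M.genericDeg d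

/-! ### `Ext¹` in the exact category `MCM_ℤ R_k` -/

/-- A short exact sequence `0 → N → E → M → 0` in `MCM_ℤ R_k`. -/
structure Extension {k : ℕ} (M N : GrMod.{u} k) where
  /-- The middle term. -/
  mid : GrMod.{u} k
  isMCM : mid.IsMCM
  /-- The inclusion of `N`. -/
  inc : GrHom N mid
  /-- The projection onto `M`. -/
  proj : GrHom mid M
  injective : Function.Injective inc.toLin
  exact : Function.Exact inc.toLin proj.toLin
  surjective : Function.Surjective proj.toLin

namespace Extension

variable {k : ℕ} {M N : GrMod.{u} k}

/-- The sequence splits, i.e. the projection has a section in `MCM_ℤ R_k`. -/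
def Splits (E : Extension M N) : Prop :=
  ∃ s : GrHom M E.mid, E.proj.toLin ∘ₗ s.toLin = LinearMap.id

/-- Yoneda equivalence: an isomorphism of the middle terms compatible with the identities of
`M` and `N`. -/
def Equivalent (E E' : Extension M N) : Prop :=
  ∃ e : GrIso E.mid E'.mid, (∀ n, e.toEquiv (E.inc.toLin n) = E'.inc.toLin n) ∧
    ∀ z, E'.proj.toLin (e.toEquiv z) = E.proj.toLin z

/-- Yoneda equivalence is an equivalence relation. -/
instance setoid (M N : GrMod.{u} k) : Setoid (Extension M N) where
  r := Equivalent
  iseqv :=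
    { refl := fun E => ⟨GrIso.refl _, fun _ => rfl, fun _ => rfl⟩
      symm := by
        rintro E E' ⟨e, h1, h2⟩
        refine ⟨e.symm, fun n => ?_, fun z => ?_⟩
        · exact (LinearEquiv.symm_apply_eq _).2 (h1 n).symm
        · rw [← h2]
          exact congrArg _ (LinearEquiv.apply_symm_apply _ _)
      trans := by
        rintro E E' E'' ⟨e, h1, h2⟩ ⟨f, h3, h4⟩
        refine ⟨e.trans f, fun n => ?_, fun z => ?_⟩
        · exact (congrArg f.toEquiv (h1 n)).trans (h3 n)
        · exact (h4 _).trans (h2 z) }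

end Extension

/-- `Ext¹(M, N)` in `MCM_ℤ R_k`: the Yoneda classes of extensions of `M` by `N`. -/
def Ext1 {k : ℕ} (M N : GrMod.{u} k) : Type (u + 1) := Quotient (Extension.setoid M N)

/-- The zero element of `Ext¹(M, N)` is the class of the split extensions. -/
def Ext1.IsZero {k : ℕ} {M N : GrMod.{u} k} (c : Ext1 M N) : Prop :=
  ∃ E : Extension M N, E.Splits ∧ Quotient.mk _ E = c

/-- `Ext¹(M, N) = 0`. -/
def Ext1Vanishes {k : ℕ} (M N : GrMod.{u} k) : Prop := ∀ c : Ext1 M N, c.IsZero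

/-! ### `k`-subsets of `ℤ` and the corresponding modules -/

/-- The `k`-subsets of `ℤ`, which label the Plücker coordinates `p_ℓ` of `𝒜_k`. -/
abbrev KSubset (k : ℕ) : Type := {s : Finset ℤ // s.card = k}

/-- Two subsets of `ℤ` cross if there are `i₁, i₂ ∈ s \ t` and `j₁, j₂ ∈ t \ s` with
`i₁ < j₁ < i₂ < j₂` or `j₁ < i₁ < j₂ < i₂`. -/
def Cross (s t : Finset ℤ) : Prop :=
  ∃ i₁ ∈ s \ t, ∃ i₂ ∈ s \ t, ∃ j₁ ∈ t \ s, ∃ j₂ ∈ t \ s,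
    (i₁ < j₁ ∧ j₁ < i₂ ∧ i₂ < j₂) ∨ (j₁ < i₁ ∧ i₁ < j₂ ∧ j₂ < i₂)

/-- The Plücker coordinates labelled by `ℓ` and `m` are compatible: `ℓ` and `m` are noncrossing. -/
def Compatible {k : ℕ} (ℓ m : KSubset k) : Prop := ¬ Cross ℓ.1 m.1

namespace KSubset

variable {k : ℕ}

/-- The entries `ℓ_1 < ⋯ < ℓ_k` of a `k`-subset, indexed here by `0, …, k - 1`. -/
def entry (ℓ : KSubset k) (p : Fin k) : ℤ := ℓ.1.orderEmbOfFin ℓ.2 p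

/-- The largest entry `ℓ_k`. -/
def top (hk : 2 ≤ k) (ℓ : KSubset k) : ℤ := ℓ.entry ⟨k - 1, by omega⟩

/-- The exponent `ℓ_k - ℓ_p - (k - p)` of `y` (for the `p` counted from `1`) in the generator
`x ^ (p - 1) * y ^ _`. This integer is never negative. -/
def yExponent (hk : 2 ≤ k) (ℓ : KSubset k) (p : Fin k) : ℕ :=
  (ℓ.top hk - ℓ.entry p - ((k : ℤ) - ((p : ℤ) + 1))).toNat

/-- The ideal `(x ^ (k-1), x ^ (k-2) y ^ (i_1), …, x y ^ (i_{k-2}), y ^ (i_{k-1}))` where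
`i_{k-p} = ℓ_k - ℓ_p - (k - p)`. -/
def ideal (hk : 2 ≤ k) (ℓ : KSubset k) : Ideal (R k) :=
  Ideal.span (Set.range fun p : Fin k => xR k ^ (p : ℕ) * yR k ^ ℓ.yExponent hk p)

theorem ideal_isHomogeneous (hk : 2 ≤ k) (ℓ : KSubset k) :
    (ℓ.ideal hk).IsHomogeneous (piece k) := by
  refine Ideal.homogeneous_span _ _ ?_
  rintro _ ⟨p, rfl⟩
  exact ⟨_, SetLike.GradedMul.mul_mem (SetLike.pow_mem_graded _ (xR_mem k))
    (SetLike.pow_mem_graded _ (yR_mem k))⟩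

/-- The graded module
`I(ℓ) = (x ^ (k-1), x ^ (k-2) y ^ (i_1), …, y ^ (i_{k-1}))(i_k)` with `i_k = k - 1 - ℓ_k`. -/
def toModule (hk : 2 ≤ k) (ℓ : KSubset k) : GrMod.{0} k :=
  (GrMod.ofIdeal k (ℓ.ideal hk) (ℓ.ideal_isHomogeneous hk)).shift ((k : ℤ) - 1 - ℓ.top hk)

end KSubset

/-- `ℓ` is the `k`-subset `ℓ(M)` corresponding to the graded module `M`: `M ≅ I(ℓ)`. -/
def Corresponds {k : ℕ} (hk : 2 ≤ k) (M : GrMod.{u} k) (ℓ : KSubset k) : Prop :=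
  Nonempty (GrIso M (ℓ.toModule hk))

end GrassmannianInf

end

/-!
Setting `y = 1` turns a graded `R_k`-module `M` on which `y` is injective into a module over `ℂ[t]
/ (t ^ k)`, filtered by the images of the homogeneous parts `M_d`. On the quotient, `x` acts as
`t`, each `M_d` embeds, `y : M_d → M_{d-1}` becomes an inclusion and `t M_d ⊆ M_{d+1}`. If `M` is
generically free of rank one, then the quotient is `ℂ[t] / (t ^ k)` itself, each `M_d` is one of
the ideals `(t ^ a)`, and the exponent `a = a(d)` grows from `0` to `k` by steps of size at most
one. Thus `a(d)` is the number of elements below `d` of a unique `k`-subset `ℓ` of `ℤ`. This is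
what a `Chart` records. A module with such a chart has generators `e_0, …, e_{k-1}` whose degrees
are the elements of `ℓ`, subject to `x e_p = y ^ _ e_{p+1}` and `x e_{k-1} = 0`, so it is
determined by `ℓ` (`Chart.iso`, `Chart.unique`); and `I(ℓ)` has such a chart (`KSubset.chart`).
The Cohen--Macaulay condition enters only through the injectivity of `y`, to which it is
equivalent (`GrMod.IsMCM.y_regular`, `GrMod.isMCM_of_y_regular`).

An extension of `I(ℓ)` by `I(m)` is governed by the failure of lifts of the `e_p` to satisfy the
relations between the `e_p`. In coordinates this is a family `r_0, …, r_{k-1}` in `ℂ[t] / (t ^ k)`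
such that `t r_p - r_{p+1}` lies in the ideal of `I(m)` in degree `ℓ_p + 1`, where `r_k = 0`
(`KSubset.IsShiftSystem`), and the extension splits if and only if some `c` makes all `r_p - t ^ p
c` lie in the ideals of degree `ℓ_p` (`Extension.splits_of_not_cross`,
`isTrivialSystem_of_splits`). Conversely every such family comes from an extension
(`twistedExtension`).

These conditions are compatible with the decomposition of the coefficients of the `r_p` into
diagonals. On each diagonal the problem is governed by the lattice path `height ℓ m d = #{x ∈ ℓ |
x < d} - #{x ∈ m | x < d}`: there is an obstruction if and only if, for some level `c ≤ 0`, the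
path reaches the level `c` between two points strictly below it, or the same holds with `ℓ` and
`m` exchanged (`HasPeak`). Since the path starts and ends at `0`, this happens if and only if it
goes up and down at least four times in alternation, which is to say that `ℓ` and `m` cross
(`HasPeak.cross`, `Cross.hasPeak_or`).
-/

noncomputable section

namespace GrassmannianInf

/-! ### Counting functions of subsets of `ℤ` and the crossing condition -/

/-- The number of elements of `s` that are smaller than `d`. -/
def below (s : Finset ℤ) (d : ℤ) : ℕ := (s.filter (· < d)).card

theorem below_mono (s : Finset ℤ) : Monotone (below s) := fun d e h =>
  Finset.card_le_card fun x hx => by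
    simp only [Finset.mem_filter] at hx ⊢
    exact ⟨hx.1, hx.2.trans_le h⟩

theorem below_le_card (s : Finset ℤ) (d : ℤ) : below s d ≤ s.card := Finset.card_filter_le _ _

theorem below_add_one (s : Finset ℤ) (d : ℤ) :
    below s (d + 1) = below s d + if d ∈ s then 1 else 0 := by
  have h : s.filter (· < d + 1) = s.filter (· < d) ∪ s.filter (· = d) := by
    ext x
    simp only [Finset.mem_union, Finset.mem_filter, Int.lt_add_one_iff, le_iff_lt_or_eq]
    tauto
  rw [below, h, Finset.card_union_of_disjoint]
  · rw [Finset.filter_eq']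
    split_ifs <;> simp [below]
  · rw [Finset.disjoint_left]
    intro x hx hx'
    simp only [Finset.mem_filter] at hx hx'
    omega

theorem below_le_add_one (s : Finset ℤ) (d : ℤ) : below s (d + 1) ≤ below s d + 1 := by
  rw [below_add_one]; split_ifs <;> omega

theorem below_le_add_sub (s : Finset ℤ) {d e : ℤ} (h : d ≤ e) :
    (below s e : ℤ) ≤ below s d + (e - d) := by
  induction e, h using Int.leInduction with
  | base => simp
  | succ e _ ih =>
    have := below_le_add_one s e
    omega

theorem exists_below_eq_zero (s : Finset ℤ) (d : ℤ) : ∃ e < d, below s e = 0 := by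
  obtain ⟨b, hb⟩ := s.bddBelow
  refine ⟨min b (d - 1), by omega, ?_⟩
  rw [below, Finset.card_eq_zero, Finset.filter_eq_empty_iff]
  intro x hx
  have := hb hx
  omega

theorem exists_below_eq_card (s : Finset ℤ) (d : ℤ) : ∃ e > d, below s e = s.card := by
  obtain ⟨b, hb⟩ := s.bddAbove
  refine ⟨max (b + 1) (d + 1), by omega, ?_⟩
  rw [below, Finset.filter_true_of_mem]
  intro x hx
  have := hb hx
  omega

/-- The difference of the counting functions of `s` and `t`. As a function of `d` it is a path that
goes up at the elements of `s \ t`, goes down at those of `t \ s`, and vanishes far out on the left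
(and on the right, if `s` and `t` have the same size). -/
def height (s t : Finset ℤ) (d : ℤ) : ℤ := below s d - below t d

theorem height_swap (s t : Finset ℤ) (d : ℤ) : height t s d = - height s t d := by
  simp [height]

theorem height_add_one_of_mem_sdiff {s t : Finset ℤ} {d : ℤ} (h : d ∈ s \ t) :
    height s t (d + 1) = height s t d + 1 := by
  rw [Finset.mem_sdiff] at h
  rw [height, height, below_add_one, below_add_one, if_pos h.1, if_neg h.2]
  push_cast
  ring

theorem exists_mem_sdiff_of_height_lt {s t : Finset ℤ} {d e : ℤ} (h : d ≤ e)
    (hlt : height s t d < height s t e) : ∃ x ∈ s \ t, d ≤ x ∧ x < e := by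
  induction e, h using Int.leInduction with
  | base => exact absurd hlt (lt_irrefl _)
  | succ e he ih =>
    by_cases h1 : height s t d < height s t e
    · obtain ⟨x, hx, h2, h3⟩ := ih h1
      exact ⟨x, hx, h2, by omega⟩
    · refine ⟨e, ?_, he, by omega⟩
      rw [height, height, below_add_one s e, below_add_one t e] at hlt
      rw [height, height] at h1
      rw [Finset.mem_sdiff]
      by_contra h2
      split_ifs at hlt <;> first | omega | tauto

theorem exists_height_eq_zero_left (s t : Finset ℤ) (d : ℤ) : ∃ e < d, height s t e = 0 := by
  obtain ⟨e, he, h1⟩ := exists_below_eq_zero s d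
  obtain ⟨f, hf, h2⟩ := exists_below_eq_zero t d
  refine ⟨min e f, by omega, ?_⟩
  have h3 := below_mono s (min_le_left e f)
  have h4 := below_mono t (min_le_right e f)
  rw [height]
  omega

theorem exists_height_eq_zero_right {s t : Finset ℤ} (hst : s.card = t.card) (d : ℤ) :
    ∃ e > d, height s t e = 0 := by
  obtain ⟨e, he, h1⟩ := exists_below_eq_card s d
  obtain ⟨f, hf, h2⟩ := exists_below_eq_card t d
  refine ⟨max e f, by omega, ?_⟩
  have h3 := below_mono s (le_max_left e f)
  have h4 := below_mono t (le_max_right e f)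
  have h5 := below_le_card s (max e f)
  have h6 := below_le_card t (max e f)
  rw [height]
  omega

/-- The path `height s t` has, for some level `c ≤ 0`, a point of height at least `c` between two
points of height less than `c`. -/
def HasPeak (s t : Finset ℤ) : Prop :=
  ∃ c ≤ 0, ∃ d₁ d₂ d₃ : ℤ, d₁ ≤ d₂ ∧ d₂ ≤ d₃ ∧
    height s t d₁ < c ∧ c ≤ height s t d₂ ∧ height s t d₃ < c

theorem Cross.symm {s t : Finset ℤ} (h : Cross s t) : Cross t s := by
  obtain ⟨i₁, h1, i₂, h2, j₁, h3, j₂, h4, h⟩ := h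
  exact ⟨j₁, h3, j₂, h4, i₁, h1, i₂, h2, h.symm⟩

theorem HasPeak.cross {s t : Finset ℤ} (hst : s.card = t.card) (h : HasPeak s t) :
    Cross s t := by
  obtain ⟨c, hc, d₁, d₂, d₃, h12, h23, h1, h2, h3⟩ := h
  obtain ⟨d₀, h01, h0⟩ := exists_height_eq_zero_left s t d₁
  obtain ⟨d₄, h34, h4⟩ := exists_height_eq_zero_right hst d₃
  obtain ⟨j₁, hj₁, _, _⟩ := exists_mem_sdiff_of_height_lt (s := t) (t := s) h01.le
    (by rw [height_swap s, height_swap s]; omega)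
  obtain ⟨i₁, hi₁, _, _⟩ := exists_mem_sdiff_of_height_lt (s := s) (t := t) h12 (by omega)
  obtain ⟨j₂, hj₂, _, _⟩ := exists_mem_sdiff_of_height_lt (s := t) (t := s) h23
    (by rw [height_swap s, height_swap s]; omega)
  obtain ⟨i₂, hi₂, _, _⟩ := exists_mem_sdiff_of_height_lt (s := s) (t := t) h34.le (by omega)
  exact ⟨i₁, hi₁, i₂, hi₂, j₁, hj₁, j₂, hj₂, Or.inr ⟨by omega, by omega, by omega⟩⟩

/-- If the path goes up, down, up and down, in this order, then there is a valley between two peaks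
of positive height, or a peak between two valleys of negative height. -/
theorem hasPeak_or_of_alternating {s t : Finset ℤ} {i₁ j₁ i₂ j₂ : ℤ} (hi₁ : i₁ ∈ s \ t)
    (hj₁ : j₁ ∈ t \ s) (hi₂ : i₂ ∈ s \ t) (hj₂ : j₂ ∈ t \ s) (h1 : i₁ < j₁) (h2 : j₁ < i₂)
    (h3 : i₂ < j₂) : HasPeak s t ∨ HasPeak t s := by
  have a1 := height_add_one_of_mem_sdiff hi₁
  have a2 := height_add_one_of_mem_sdiff hi₂
  have b1 := height_add_one_of_mem_sdiff hj₁
  have b2 := height_add_one_of_mem_sdiff hj₂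
  rw [height_swap s, height_swap s] at b1 b2
  -- a valley between the first descent and the second ascent, together with higher points on
  -- both sides
  obtain ⟨v, l, r, hil, hlv, hvr, hrj, hl, hr⟩ : ∃ v l r : ℤ, i₁ + 1 ≤ l ∧ l ≤ v ∧ v ≤ r ∧ r ≤ j₂ ∧
      height s t v + 1 ≤ height s t l ∧ height s t v + 1 ≤ height s t r := by
    by_cases h : height s t (j₁ + 1) ≤ height s t i₂
    · exact ⟨j₁ + 1, j₁, i₂ + 1, by omega, by omega, by omega, by omega, by omega, by omega⟩
    · exact ⟨i₂, j₁, i₂ + 1, by omega, by omega, by omega, by omega, by omega, by omega⟩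
  have key : ∀ c : ℤ, 1 ≤ c → ∀ d₁ d₂ d₃, d₁ ≤ d₂ → d₂ ≤ d₃ → c ≤ height s t d₁ →
      height s t d₂ < c → c ≤ height s t d₃ → HasPeak t s := fun c hc d₁ d₂ d₃ h12 h23 e1 e2 e3 =>
    ⟨1 - c, by omega, d₁, d₂, d₃, h12, h23, by rw [height_swap s]; omega,
      by rw [height_swap s]; omega, by rw [height_swap s]; omega⟩
  by_cases hv : 0 ≤ height s t v
  · exact Or.inr (key (height s t v + 1) (by omega) l v r hlv hvr hl (by omega) hr)
  by_cases hL : 1 ≤ height s t (i₁ + 1)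
  · by_cases hR : 1 ≤ height s t j₂
    · exact Or.inr (key 1 le_rfl (i₁ + 1) v j₂ (by omega) (by omega) hL (by omega) hR)
    · refine Or.inl ?_
      by_cases h : height s t (j₂ + 1) ≤ height s t v
      · exact ⟨height s t v + 1, by omega, v, r, j₂ + 1, hvr, by omega, by omega, hr, by omega⟩
      · exact ⟨height s t (j₂ + 1) + 1, by omega, v, j₂, j₂ + 1, by omega, by omega, by omega,
          by omega, by omega⟩
  · refine Or.inl ?_
    by_cases h : height s t i₁ ≤ height s t v
    · exact ⟨height s t v + 1, by omega, i₁, l, v, by omega, by omega, by omega, by omega,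
        by omega⟩
    · exact ⟨height s t i₁ + 1, by omega, i₁, i₁ + 1, v, by omega, by omega, by omega, by omega,
        by omega⟩

theorem Cross.hasPeak_or {s t : Finset ℤ} (h : Cross s t) : HasPeak s t ∨ HasPeak t s := by
  obtain ⟨i₁, h1, i₂, h2, j₁, h3, j₂, h4, ⟨a, b, c⟩ | ⟨a, b, c⟩⟩ := h
  · exact hasPeak_or_of_alternating h1 h3 h2 h4 a b c
  · exact (hasPeak_or_of_alternating h3 h1 h4 h2 a b c).symm

namespace KSubset

variable {k : ℕ} (ℓ m : KSubset k)

/-- The `p`-th smallest element of a `k`-subset, for `p < k`; the value is `0` for `p ≥ k`. -/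
def nth (p : ℕ) : ℤ := if h : p < k then ℓ.entry ⟨p, h⟩ else 0

variable {ℓ}

theorem nth_mem {p : ℕ} (hp : p < k) : ℓ.nth p ∈ ℓ.1 := by
  rw [nth, dif_pos hp]
  exact Finset.orderEmbOfFin_mem _ _ _

theorem below_nth {p : ℕ} (hp : p < k) : below ℓ.1 (ℓ.nth p) = p := by
  have h : ℓ.1.filter (· < ℓ.nth p) =
      (Finset.univ.filter (fun q : Fin k => (q : ℕ) < p)).map
        (ℓ.1.orderEmbOfFin ℓ.2).toEmbedding := by
    ext x
    simp only [Finset.mem_filter, Finset.mem_map, Finset.mem_univ, true_and]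
    rw [nth, dif_pos hp, entry]
    constructor
    · rintro ⟨h1, h2⟩
      have h3 : x ∈ Set.range (ℓ.1.orderEmbOfFin ℓ.2) := by
        rw [Finset.range_orderEmbOfFin]; exact h1
      obtain ⟨q, rfl⟩ := h3
      exact ⟨q, by simpa [Fin.lt_def] using h2, rfl⟩
    · rintro ⟨q, h1, rfl⟩
      exact ⟨Finset.orderEmbOfFin_mem _ _ _, by simpa [Fin.lt_def] using h1⟩
  rw [below, h, Finset.card_map, Fin.card_filter_val_lt]
  omega

theorem below_nth_add_one {p : ℕ} (hp : p < k) : below ℓ.1 (ℓ.nth p + 1) = p + 1 := by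
  rw [below_add_one, below_nth hp, if_pos (nth_mem hp)]

theorem nth_lt_iff {p : ℕ} (hp : p < k) {d : ℤ} : ℓ.nth p < d ↔ p < below ℓ.1 d := by
  constructor
  · intro h
    have := below_mono ℓ.1 (show ℓ.nth p + 1 ≤ d by omega)
    rw [below_nth_add_one hp] at this
    omega
  · intro h
    by_contra h1
    have := below_mono ℓ.1 (not_lt.1 h1)
    rw [below_nth hp] at this
    omega

theorem le_nth_iff {p : ℕ} (hp : p < k) {d : ℤ} : d ≤ ℓ.nth p ↔ below ℓ.1 d ≤ p := by
  rw [← not_lt, nth_lt_iff hp, not_lt]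

theorem nth_lt_nth {p : ℕ} (hp : p + 1 < k) : ℓ.nth p < ℓ.nth (p + 1) := by
  rw [nth_lt_iff (by omega), below_nth hp]
  omega

theorem below_le (d : ℤ) : below ℓ.1 d ≤ k := (below_le_card _ _).trans ℓ.2.le

variable {m}

/-- The condition `HasPeak ℓ m` in terms of the elements of `ℓ`. -/
theorem hasPeak_iff : HasPeak ℓ.1 m.1 ↔ ∃ i p s q : ℕ, p ≤ s ∧ s < q ∧ q + i < k ∧
    p + i < below m.1 (ℓ.nth p) ∧ below m.1 (ℓ.nth s + 1) ≤ s + i + 1 ∧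
    q + i < below m.1 (ℓ.nth q) := by
  constructor
  · rintro ⟨c, hc, d₁, d₂, d₃, h12, h23, h1, h2, h3⟩
    have n1 := below_mono ℓ.1 h12
    have n2 := below_mono ℓ.1 h23
    have m1 := below_mono m.1 h12
    have m2 := below_mono m.1 h23
    have l3 := below_le (ℓ := ℓ) d₃
    have l4 := below_le (ℓ := m) d₃
    rw [height] at h1 h2 h3
    have e1 := below_mono m.1 ((le_nth_iff (ℓ := ℓ) (p := below ℓ.1 d₁) (by omega)).2 le_rfl)
    have e3 := below_mono m.1 ((le_nth_iff (ℓ := ℓ) (p := below ℓ.1 d₃) (by omega)).2 le_rfl)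
    have e2 := below_mono m.1 (show ℓ.nth (below ℓ.1 d₂ - 1) + 1 ≤ d₂ from
      (nth_lt_iff (ℓ := ℓ) (p := below ℓ.1 d₂ - 1) (d := d₂) (by omega)).2 (by omega))
    exact ⟨(-c).toNat, below ℓ.1 d₁, below ℓ.1 d₂ - 1, below ℓ.1 d₃, by omega, by omega,
      by omega, by omega, by omega, by omega⟩
  · rintro ⟨i, p, s, q, hps, hsq, hq, h1, h2, h3⟩
    have e1 := below_nth (ℓ := ℓ) (p := p) (by omega)
    have e2 := below_nth_add_one (ℓ := ℓ) (p := s) (by omega)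
    have e3 := below_nth (ℓ := ℓ) (p := q) (by omega)
    refine ⟨-i, by omega, ℓ.nth p, ℓ.nth s + 1, ℓ.nth q, ?_, ?_, ?_, ?_, ?_⟩
    · rw [← not_lt]
      intro h
      have := below_mono ℓ.1 h.le
      omega
    · exact (nth_lt_iff (by omega)).2 (by omega)
    all_goals rw [height]; omega

/-- The condition `HasPeak m ℓ` in terms of the elements of `ℓ`. -/
theorem hasPeak_swap_iff : HasPeak m.1 ℓ.1 ↔ ∃ i p s q : ℕ, p ≤ s ∧ s < q ∧ q + i < k ∧
    below m.1 (ℓ.nth (p + i) + 1) ≤ p ∧ s < below m.1 (ℓ.nth (s + i + 1)) ∧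
    below m.1 (ℓ.nth (q + i) + 1) ≤ q := by
  constructor
  · rintro ⟨c, hc, d₁, d₂, d₃, h12, h23, h1, h2, h3⟩
    have n1 := below_mono ℓ.1 h12
    have n2 := below_mono ℓ.1 h23
    have m1 := below_mono m.1 h12
    have m2 := below_mono m.1 h23
    have l3 := below_le (ℓ := ℓ) d₃
    have l4 := below_le (ℓ := m) d₃
    rw [height] at h1 h2 h3
    have e2 := below_mono m.1 ((le_nth_iff (ℓ := ℓ) (p := below ℓ.1 d₂) (by omega)).2 le_rfl)
    have e1 := below_mono m.1 (show ℓ.nth (below ℓ.1 d₁ - 1) + 1 ≤ d₁ from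
      (nth_lt_iff (ℓ := ℓ) (p := below ℓ.1 d₁ - 1) (d := d₁) (by omega)).2 (by omega))
    have e3 := below_mono m.1 (show ℓ.nth (below ℓ.1 d₃ - 1) + 1 ≤ d₃ from
      (nth_lt_iff (ℓ := ℓ) (p := below ℓ.1 d₃ - 1) (d := d₃) (by omega)).2 (by omega))
    obtain ⟨i, rfl⟩ : ∃ i : ℕ, c = -i := ⟨(-c).toNat, by omega⟩
    refine ⟨i, below ℓ.1 d₁ - 1 - i, below ℓ.1 d₂ - 1 - i, below ℓ.1 d₃ - 1 - i, by omega,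
      by omega, by omega, ?_, ?_, ?_⟩
    · rw [show below ℓ.1 d₁ - 1 - i + i = below ℓ.1 d₁ - 1 by omega]
      omega
    · rw [show below ℓ.1 d₂ - 1 - i + i + 1 = below ℓ.1 d₂ by omega]
      omega
    · rw [show below ℓ.1 d₃ - 1 - i + i = below ℓ.1 d₃ - 1 by omega]
      omega
  · rintro ⟨i, p, s, q, hps, hsq, hq, h1, h2, h3⟩
    have e1 := below_nth_add_one (ℓ := ℓ) (p := p + i) (by omega)
    have e2 := below_nth (ℓ := ℓ) (p := s + i + 1) (by omega)
    have e3 := below_nth_add_one (ℓ := ℓ) (p := q + i) (by omega)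
    refine ⟨-i, by omega, ℓ.nth (p + i) + 1, ℓ.nth (s + i + 1), ℓ.nth (q + i) + 1, ?_, ?_, ?_, ?_,
      ?_⟩
    · exact (nth_lt_iff (by omega)).2 (by omega)
    · rw [← not_lt]
      intro h
      have := below_mono ℓ.1 h.le
      omega
    all_goals rw [height]; omega

end KSubset

/-! ### Shift systems -/

/-- Multiplication by `t` on `ℂ[t] / (t ^ k)`, in terms of coefficient sequences. -/
def shift (k : ℕ) : (ℕ → ℂ) →ₗ[ℂ] (ℕ → ℂ) where
  toFun v j := if 0 < j ∧ j < k then v (j - 1) else 0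
  map_add' v w := by ext j; dsimp only [Pi.add_apply]; split_ifs <;> simp
  map_smul' c v := by ext j; simp

theorem shift_apply (k : ℕ) (v : ℕ → ℂ) (j : ℕ) :
    shift k v j = if 0 < j ∧ j < k then v (j - 1) else 0 := rfl

theorem shift_zero (k : ℕ) (v : ℕ → ℂ) : shift k v 0 = 0 := by simp [shift_apply]

theorem shift_succ {k j : ℕ} (v : ℕ → ℂ) (h : j + 1 < k) : shift k v (j + 1) = v j := by
  simp [shift_apply, h]

namespace KSubset

variable {k : ℕ} (ℓ m : KSubset k)

/-- A family `r_0, …, r_{k-1}` in `ℂ[t] / (t ^ k)` with `t r_p ≡ r_{p+1}` (where `r_k = 0`) modulo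
the ideal `(t ^ b)`, where `b` is the number of elements of `m` up to the `p`-th element of `ℓ`.
Such families describe the extensions of `I(ℓ)` by `I(m)`. -/
structure IsShiftSystem (r : ℕ → ℕ → ℂ) : Prop where
  last : r k = 0
  link : ∀ p < k, ∀ j < below m.1 (ℓ.nth p + 1), shift k (r p) j = r (p + 1) j

/-- The family `r` agrees with a family `c, t c, t² c, …`, where the `p`-th term is taken modulo
`(t ^ a)`, with `a` the number of elements of `m` below the `p`-th element of `ℓ`. -/
def IsTrivialSystem (r : ℕ → ℕ → ℂ) : Prop :=
  ∃ c : ℕ → ℂ, ∀ p < k, ∀ j < below m.1 (ℓ.nth p), r p j = if p ≤ j then c (j - p) else 0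

variable {ℓ m}

theorem IsShiftSystem.link_zero {r : ℕ → ℕ → ℂ} (hr : IsShiftSystem ℓ m r) {p : ℕ} (hp : p < k)
    (h : 0 < below m.1 (ℓ.nth p + 1)) : r (p + 1) 0 = 0 := by
  rw [← hr.link p hp 0 h, shift_zero]

theorem IsShiftSystem.link_succ {r : ℕ → ℕ → ℂ} (hr : IsShiftSystem ℓ m r) {p j : ℕ} (hp : p < k)
    (h : j + 1 < below m.1 (ℓ.nth p + 1)) : r (p + 1) (j + 1) = r p j := by
  rw [← hr.link p hp _ h, shift_succ _ (h.trans_le (below_le _))]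

/-- Without a peak between two valleys, all values that matter on a diagonal `j = p + i` agree. -/
theorem IsShiftSystem.diagonal_eq {r : ℕ → ℕ → ℂ} (hr : IsShiftSystem ℓ m r)
    (h : ¬ HasPeak ℓ.1 m.1) {i p q : ℕ} (hpq : p ≤ q)
    (h1 : p + i < below m.1 (ℓ.nth p)) (h2 : q + i < below m.1 (ℓ.nth q)) :
    r q (q + i) = r p (p + i) := by
  have hqk : q + i < k := h2.trans_le (below_le _)
  have key : ∀ s, p ≤ s → s ≤ q → r s (s + i) = r p (p + i) := by
    intro s hs
    induction s, hs using Nat.le_induction with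
    | base => exact fun _ => rfl
    | succ s hs ih =>
      intro hsq
      rw [← ih (by omega), show s + 1 + i = s + i + 1 by ring]
      refine hr.link_succ (by omega) ?_
      by_contra h3
      exact h (hasPeak_iff.2 ⟨i, p, s, q, hs, by omega, by omega, h1, by omega, h2⟩)
  exact key q hpq le_rfl

/-- Without a valley between two peaks, all values that matter on a diagonal `p = j + i + 1`
vanish: either the links back to `j = 0` or the links forward to `p = k` are intact. -/
theorem IsShiftSystem.diagonal_eq_zero {r : ℕ → ℕ → ℂ} (hr : IsShiftSystem ℓ m r)
    (h : ¬ HasPeak m.1 ℓ.1) {i s : ℕ} (hs : s + i + 1 < k)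
    (h1 : s < below m.1 (ℓ.nth (s + i + 1))) : r (s + i + 1) s = 0 := by
  by_cases h2 : ∀ p ≤ s, p < below m.1 (ℓ.nth (p + i) + 1)
  · have key : ∀ p ≤ s, r (p + i + 1) p = 0 := by
      intro p
      induction p with
      | zero => exact fun hp => hr.link_zero (by omega) (h2 0 hp)
      | succ p ih =>
        intro hp
        rw [← ih (by omega), hr.link_succ (by omega) (h2 _ hp), show p + 1 + i = p + i + 1 by ring]
    exact key s le_rfl
  · push Not at h2
    obtain ⟨p, hp, h2⟩ := h2
    have key : ∀ q, s ≤ q → q + i + 1 ≤ k → r (q + i + 1) q = r (s + i + 1) s := by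
      intro q hq
      induction q, hq using Nat.le_induction with
      | base => exact fun _ => rfl
      | succ q hq ih =>
        intro hqk
        rw [← ih (by omega), hr.link_succ (by omega), show q + 1 + i = q + i + 1 by ring]
        by_contra h3
        exact h (hasPeak_swap_iff.2 ⟨i, p, s, q + 1, hp, by omega, by omega, h2, h1, by omega⟩)
    rw [← key (k - 1 - i) (by omega) (by omega), show k - 1 - i + i + 1 = k by omega, hr.last]
    rfl

theorem IsShiftSystem.isTrivialSystem {r : ℕ → ℕ → ℂ} (hr : IsShiftSystem ℓ m r)
    (h : ¬ Cross ℓ.1 m.1) : IsTrivialSystem ℓ m r := by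
  classical
  have hA : ¬ HasPeak ℓ.1 m.1 := fun h1 => h (h1.cross (ℓ.2.trans m.2.symm))
  have hB : ¬ HasPeak m.1 ℓ.1 := fun h1 => h (h1.cross (m.2.trans ℓ.2.symm)).symm
  refine ⟨fun i => if h : ∃ p < k, p + i < below m.1 (ℓ.nth p) then
    r h.choose (h.choose + i) else 0, fun p hp j hj => ?_⟩
  split_ifs with hpj
  · obtain ⟨i, rfl⟩ := Nat.exists_eq_add_of_le hpj
    rw [Nat.add_sub_cancel_left]
    have h1 : ∃ p < k, p + i < below m.1 (ℓ.nth p) := ⟨p, hp, hj⟩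
    dsimp only
    rw [dif_pos h1]
    rcases le_total p h1.choose with h2 | h2
    · exact (hr.diagonal_eq hA h2 hj h1.choose_spec.2).symm
    · exact hr.diagonal_eq hA h2 h1.choose_spec.2 hj
  · obtain ⟨i, rfl⟩ := Nat.exists_eq_add_of_lt (not_le.1 hpj)
    exact hr.diagonal_eq_zero hB hp hj

/-- Crossing `k`-subsets admit a nontrivial shift system, supported on one diagonal. -/
theorem exists_isShiftSystem_of_cross (h : Cross ℓ.1 m.1) :
    ∃ r : ℕ → ℕ → ℂ, IsShiftSystem ℓ m r ∧ (∀ p j, k ≤ j → r p j = 0) ∧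
      ¬ IsTrivialSystem ℓ m r := by
  rcases h.hasPeak_or with h | h
  · obtain ⟨i, p, s, q, hps, hsq, hqk, h1, h2, h3⟩ := hasPeak_iff.1 h
    refine ⟨fun a j => if j = a + i ∧ a ≤ s ∧ j < k then 1 else 0, ⟨?_, fun a ha j hj => ?_⟩,
      fun a j hj => if_neg (by omega), ?_⟩
    · ext j
      exact if_neg (by omega)
    · rcases j with _ | j
      · rw [shift_zero, if_neg (by omega)]
      · rw [shift_succ _ (hj.trans_le (below_le _))]
        have hjk := hj.trans_le (below_le (ℓ := m) _)
        -- the links at the row `s` would require `s + i + 1 < below m (nth s + 1)`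
        have hs : a = s → j ≠ a + i := by
          rintro rfl rfl
          omega
        exact if_congr (by omega) rfl rfl
    · rintro ⟨c, hc⟩
      have e1 := hc p (by omega) (p + i) h1
      have e2 := hc q (by omega) (q + i) h3
      dsimp only at e1 e2
      rw [if_pos (by omega), if_pos (by omega), Nat.add_sub_cancel_left] at e1
      rw [if_neg (by omega), if_pos (by omega), Nat.add_sub_cancel_left, ← e1] at e2
      exact zero_ne_one e2
  · obtain ⟨i, p, s, q, hps, hsq, hqk, h1, h2, h3⟩ := hasPeak_swap_iff.1 h
    refine ⟨fun a j => if a = j + i + 1 ∧ p ≤ j ∧ j < q then 1 else 0, ⟨?_, fun a ha j hj => ?_⟩,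
      fun a j hj => if_neg (by omega), ?_⟩
    · ext j
      exact if_neg (by omega)
    · have hp : j = p → a ≠ j + i := by
        rintro rfl rfl
        omega
      have hq : j = q → a ≠ j + i := by
        rintro rfl rfl
        omega
      rcases j with _ | j
      · rw [shift_zero, if_neg (by omega)]
      · rw [shift_succ _ (hj.trans_le (below_le _))]
        exact if_congr (by omega) rfl rfl
    · rintro ⟨c, hc⟩
      have e1 := hc (s + i + 1) (by omega) s h2
      dsimp only at e1
      rw [if_pos (by omega), if_neg (by omega)] at e1
      exact one_ne_zero e1

end KSubset

/-! ### Setting `y = 1` in the ring `R_k` -/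

section Coefficients

variable {k : ℕ}

/-- A property of elements of `R_k` that is stable under sums and products holds for all elements
if it holds for the scalars, `x` and `y`. -/
theorem R_induction {P : R k → Prop} (scalar : ∀ c : ℂ, P (algebraMap ℂ (R k) c))
    (x : P (xR k)) (y : P (yR k)) (add : ∀ r s, P r → P s → P (r + s))
    (mul : ∀ r s, P r → P s → P (r * s)) (r : R k) : P r := by
  obtain ⟨f, rfl⟩ := Ideal.Quotient.mk_surjective r
  induction f using MvPolynomial.induction_on with
  | C c => exact scalar c
  | add p q hp hq => rw [map_add]; exact add _ _ hp hq
  | mul_X p i hp =>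
    rw [map_mul]
    refine mul _ _ hp ?_
    fin_cases i
    · exact x
    · exact y

/-- Being closed under `R_k` follows from being closed under the scalars, `x` and `y`. -/
theorem smul_mem_of_generators {M : Type u} [AddCommGroup M] [Module (R k) M] (S : AddSubgroup M)
    (scalar : ∀ (c : ℂ), ∀ z ∈ S, algebraMap ℂ (R k) c • z ∈ S) (x : ∀ z ∈ S, xR k • z ∈ S)
    (y : ∀ z ∈ S, yR k • z ∈ S) (r : R k) : ∀ z ∈ S, r • z ∈ S := by
  induction r using R_induction with
  | scalar c => exact scalar c
  | x => exact x
  | y => exact y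
  | add r s hr hs => exact fun z hz => by rw [add_smul]; exact add_mem (hr z hz) (hs z hz)
  | mul r s hr hs => exact fun z hz => by rw [mul_smul]; exact hr _ (hs z hz)

/-- An additive map that commutes with the scalars, `x` and `y` is `R_k`-linear. -/
def linearMapOfGenerators {M : Type u} {N : Type v} [AddCommGroup M] [Module (R k) M]
    [AddCommGroup N] [Module (R k) N] (f : M →+ N)
    (scalar : ∀ (c : ℂ) z, f (algebraMap ℂ (R k) c • z) = algebraMap ℂ (R k) c • f z)
    (x : ∀ z, f (xR k • z) = xR k • f z) (y : ∀ z, f (yR k • z) = yR k • f z) :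
    M →ₗ[R k] N where
  toFun := f
  map_add' := f.map_add
  map_smul' r := by
    induction r using R_induction with
    | scalar c => exact scalar c
    | x => exact x
    | y => exact y
    | add r s hr hs =>
      intro z
      simp only [RingHom.id_apply] at *
      rw [add_smul, map_add, hr, hs, add_smul]
    | mul r s hr hs =>
      intro z
      simp only [RingHom.id_apply] at *
      rw [mul_smul, hr, hs, mul_smul]

theorem zero_smul_eq {M : Type u} [AddCommGroup M] [Module (R k) M] (z : M) : (0 : R k) • z = 0 :=
  zero_smul (R k) z

theorem xR_pow_eq_zero : xR k ^ k = 0 := by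
  rw [xR, ← map_pow]
  exact Ideal.Quotient.eq_zero_iff_mem.2 (Ideal.mem_span_singleton_self _)

theorem algebraMap_mem_piece (c : ℂ) : algebraMap ℂ (R k) c ∈ piece k 0 := by
  rw [← AlgHom.commutes (toR k) c]
  exact toR_mem_piece (MvPolynomial.isWeightedHomogeneous_C weight c)

theorem monomial_mem_piece (a b : ℕ) : xR k ^ a * yR k ^ b ∈ piece k (a - b) := by
  have := SetLike.GradedMul.mul_mem (SetLike.pow_mem_graded a (xR_mem k))
    (SetLike.pow_mem_graded b (yR_mem k))
  simpa [sub_eq_add_neg] using this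

/-- The coefficients of `f(t, 1)` modulo `t ^ k`. -/
def polyCoeff (k : ℕ) : Poly →ₗ[ℂ] (ℕ → ℂ) where
  toFun f j := if j < k then
    (MvPolynomial.aeval (![Polynomial.X, 1] : Fin 2 → Polynomial ℂ) f).coeff j else 0
  map_add' f g := by ext j; dsimp only [Pi.add_apply]; split_ifs <;> simp
  map_smul' c f := by ext j; simp

theorem relIdeal_le_ker_polyCoeff :
    (relIdeal k).restrictScalars ℂ ≤ LinearMap.ker (polyCoeff k) := by
  intro f hf
  obtain ⟨g, rfl⟩ := Ideal.mem_span_singleton.1 hf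
  ext j
  simp only [polyCoeff, LinearMap.coe_mk, AddHom.coe_mk, map_mul, map_pow, MvPolynomial.aeval_X,
    Matrix.cons_val_zero, Pi.zero_apply, ite_eq_right_iff]
  intro hj
  rw [Polynomial.coeff_X_pow_mul', if_neg (by omega)]

/-- The map `R_k → R_k / (y - 1) = ℂ[t] / (t ^ k)`, in terms of coefficient sequences. -/
def coeffR (k : ℕ) : R k →ₗ[ℂ] (ℕ → ℂ) :=
  Submodule.liftQ ((relIdeal k).restrictScalars ℂ) (polyCoeff k) relIdeal_le_ker_polyCoeff ∘ₗ
    (Submodule.Quotient.restrictScalarsEquiv ℂ (relIdeal k)).symm.toLinearMap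

theorem coeffR_toR (f : Poly) : coeffR k (toR k f) = polyCoeff k f := rfl

theorem coeffR_eq_zero_of_le (r : R k) {j : ℕ} (hj : k ≤ j) : coeffR k r j = 0 := by
  obtain ⟨f, rfl⟩ := Ideal.Quotient.mk_surjective r
  exact if_neg (by omega)

theorem coeffR_x_mul (r : R k) : coeffR k (xR k * r) = shift k (coeffR k r) := by
  obtain ⟨f, rfl⟩ := Ideal.Quotient.mk_surjective r
  change coeffR k (toR k (MvPolynomial.X 0) * toR k f) = shift k (coeffR k (toR k f))
  rw [← map_mul, coeffR_toR, coeffR_toR]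
  ext j
  rcases j with _ | j
  · simp [polyCoeff, shift_zero]
  · rw [shift_apply]
    simp only [polyCoeff, LinearMap.coe_mk, AddHom.coe_mk, map_mul, MvPolynomial.aeval_X,
      Matrix.cons_val_zero, Polynomial.coeff_X_mul]
    by_cases h : j + 1 < k
    · simp [h, show j < k by omega]
    · simp [h]

theorem coeffR_y_mul (r : R k) : coeffR k (yR k * r) = coeffR k r := by
  obtain ⟨f, rfl⟩ := Ideal.Quotient.mk_surjective r
  change coeffR k (toR k (MvPolynomial.X 1) * toR k f) = (coeffR k (toR k f))
  rw [← map_mul, coeffR_toR, coeffR_toR]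
  ext j
  simp [polyCoeff]

theorem coeffR_y_pow_mul (n : ℕ) (r : R k) : coeffR k (yR k ^ n * r) = coeffR k r := by
  induction n with
  | zero => simp
  | succ n ih => rw [pow_succ', mul_assoc, coeffR_y_mul, ih]

theorem coeffR_monomial {a : ℕ} (ha : a < k) (b : ℕ) :
    coeffR k (xR k ^ a * yR k ^ b) = Pi.single a 1 := by
  rw [xR, yR, ← map_pow, ← map_pow, ← map_mul, coeffR_toR]
  ext j
  simp only [polyCoeff, LinearMap.coe_mk, AddHom.coe_mk, map_mul, map_pow, MvPolynomial.aeval_X,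
    Matrix.cons_val_zero, Matrix.cons_val_one, one_pow, mul_one, Polynomial.coeff_X_pow,
    Pi.single_apply]
  split_ifs <;> first | rfl | omega

/-- A homogeneous element of `R_k` is determined by its coefficients, and those of index smaller
than the degree vanish. -/
theorem eq_sum_coeffR {d : ℤ} {r : R k} (hr : r ∈ piece k d) :
    (∀ j : ℕ, (j : ℤ) < d → coeffR k r j = 0) ∧
      r = ∑ j ∈ Finset.range k, coeffR k r j • (xR k ^ j * yR k ^ (j - d).toNat) := by
  obtain ⟨f, hf, rfl⟩ := hr
  change (∀ j : ℕ, (j : ℤ) < d → coeffR k (toR k f) j = 0) ∧ toR k f =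
    ∑ j ∈ Finset.range k, coeffR k (toR k f) j • (xR k ^ j * yR k ^ (j - d).toNat)
  have hmon : ∀ s ∈ f.support, (∀ j : ℕ, (j : ℤ) < d →
      coeffR k (toR k (MvPolynomial.monomial s (f.coeff s))) j = 0) ∧
      toR k (MvPolynomial.monomial s (f.coeff s)) = ∑ j ∈ Finset.range k,
        coeffR k (toR k (MvPolynomial.monomial s (f.coeff s))) j •
          (xR k ^ j * yR k ^ (j - d).toNat) := by
    intro s hs
    have h1 := hf (MvPolynomial.mem_support_iff.1 hs)
    rw [Finsupp.weight_apply, Finsupp.sum_fintype _ _ (by simp), Fin.sum_univ_two] at h1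
    simp only [weight, Matrix.cons_val_zero, Matrix.cons_val_one, nsmul_eq_mul, mul_one,
      mul_neg] at h1
    have h2 : toR k (MvPolynomial.monomial s (f.coeff s)) =
        f.coeff s • (xR k ^ s 0 * yR k ^ s 1) := by
      rw [MvPolynomial.monomial_eq, Finsupp.prod_fintype _ _ (by simp), Fin.prod_univ_two,
        ← MvPolynomial.smul_eq_C_mul, map_smul, map_mul, map_pow, map_pow]
      rfl
    rw [h2, map_smul]
    by_cases h3 : s 0 < k
    · rw [coeffR_monomial h3]
      refine ⟨fun j hj => ?_, ?_⟩
      · rw [Pi.smul_apply, Pi.single_eq_of_ne (by omega), smul_zero]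
      · rw [Finset.sum_eq_single (s 0)]
        · rw [Pi.smul_apply, Pi.single_eq_same, show ((s 0 : ℕ) - d).toNat = s 1 by omega,
            smul_eq_mul, mul_one]
        · intro j _ hj
          rw [Pi.smul_apply, Pi.single_eq_of_ne hj, smul_zero, zero_smul]
        · exact fun h => absurd (Finset.mem_range.2 h3) h
    · rw [← Nat.sub_add_cancel (not_lt.1 h3), pow_add, xR_pow_eq_zero, mul_zero, zero_mul,
        map_zero, smul_zero]
      simp
  constructor
  · intro j hj
    conv_lhs => rw [MvPolynomial.as_sum f]
    rw [map_sum, map_sum, Finset.sum_apply]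
    exact Finset.sum_eq_zero fun s hs => (hmon s hs).1 j hj
  · conv_lhs => rw [MvPolynomial.as_sum f, map_sum, Finset.sum_congr rfl fun s hs => (hmon s hs).2]
    rw [Finset.sum_comm]
    refine Finset.sum_congr rfl fun j _ => ?_
    rw [← Finset.sum_smul]
    congr 1
    conv_rhs => rw [MvPolynomial.as_sum f]
    rw [map_sum, map_sum, Finset.sum_apply]

theorem eq_zero_of_coeffR_eq_zero {d : ℤ} {r : R k} (hr : r ∈ piece k d) (h : coeffR k r = 0) :
    r = 0 := by
  rw [(eq_sum_coeffR hr).2, h]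
  simp

theorem exists_piece_coeffR_eq (d : ℤ) (v : ℕ → ℂ) (hv : ∀ j : ℕ, (j < d ∨ k ≤ j) → v j = 0) :
    (∑ j ∈ Finset.range k, v j • (xR k ^ j * yR k ^ (j - d).toNat)) ∈ piece k d ∧
      coeffR k (∑ j ∈ Finset.range k, v j • (xR k ^ j * yR k ^ (j - d).toNat)) = v := by
  constructor
  · refine sum_mem fun j _ => ?_
    by_cases hj : (j : ℤ) < d
    · rw [hv j (Or.inl hj), zero_smul]
      exact zero_mem _
    · refine Submodule.smul_mem _ _ ?_
      have := monomial_mem_piece (k := k) j (j - d).toNat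
      rwa [show (j : ℤ) - ((j - d).toNat : ℕ) = d by omega] at this
  · ext i
    rw [map_sum, Finset.sum_apply]
    by_cases hi : i < k
    · rw [Finset.sum_eq_single i]
      · rw [map_smul, coeffR_monomial hi, Pi.smul_apply, Pi.single_eq_same, smul_eq_mul, mul_one]
      · intro j hj hji
        rw [map_smul, coeffR_monomial (Finset.mem_range.1 hj), Pi.smul_apply,
          Pi.single_eq_of_ne hji.symm, smul_zero]
      · exact fun h => absurd (Finset.mem_range.2 hi) h
    · rw [hv i (Or.inr (not_lt.1 hi))]
      refine Finset.sum_eq_zero fun j hj => ?_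
      rw [map_smul, coeffR_monomial (Finset.mem_range.1 hj), Pi.smul_apply,
        Pi.single_eq_of_ne (by have := Finset.mem_range.1 hj; omega), smul_zero]

theorem piece_eq_zero_of_le {d : ℤ} (hd : k ≤ d) {r : R k} (hr : r ∈ piece k d) : r = 0 := by
  refine eq_zero_of_coeffR_eq_zero hr ?_
  ext j
  by_cases h : j < k
  · exact (eq_sum_coeffR hr).1 j (by omega)
  · exact coeffR_eq_zero_of_le r (not_lt.1 h)

theorem eq_zero_of_yR_mul_eq_zero {r : R k} (h : yR k * r = 0) : r = 0 := by
  obtain ⟨f, rfl⟩ := Ideal.Quotient.mk_surjective r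
  rw [yR, show toR k (MvPolynomial.X 1) =
      Ideal.Quotient.mk (relIdeal k) (MvPolynomial.X 1) from rfl,
    ← map_mul, Ideal.Quotient.eq_zero_iff_mem, relIdeal, Ideal.mem_span_singleton] at h
  rw [Ideal.Quotient.eq_zero_iff_mem, relIdeal, Ideal.mem_span_singleton]
  refine (MvPolynomial.X_prime (i := 0)).pow_dvd_of_dvd_mul_left k ?_ h
  rw [MvPolynomial.X_dvd_X]
  simp

theorem eq_zero_of_yR_pow_mul_eq_zero {r : R k} (n : ℕ) (h : yR k ^ n * r = 0) : r = 0 := by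
  induction n with
  | zero => simpa using h
  | succ n ih => exact ih (eq_zero_of_yR_mul_eq_zero (by rwa [← mul_assoc, ← pow_succ']))

end Coefficients

/-! ### Homogeneous components -/

namespace GrMod

variable {k : ℕ} (M : GrMod.{u} k)

instance decomposition : DirectSum.Decomposition M.deg := M.isInternal.chooseDecomposition

/-- The homogeneous component of degree `d`. -/
def comp (d : ℤ) : M.carrier →+ M.carrier :=
  (M.deg d).subtype.comp
    ((DFinsupp.evalAddMonoidHom d).comp (DirectSum.decomposeAddEquiv M.deg).toAddMonoidHom)

variable {M}

theorem comp_apply (d : ℤ) (z : M.carrier) : M.comp d z = DirectSum.decompose M.deg z d := rfl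

theorem comp_mem (d : ℤ) (z : M.carrier) : M.comp d z ∈ M.deg d :=
  (DirectSum.decompose M.deg z d).2

theorem comp_of_mem {d : ℤ} {z : M.carrier} (hz : z ∈ M.deg d) : M.comp d z = z :=
  DirectSum.decompose_of_mem_same M.deg hz

theorem comp_of_mem_ne {d e : ℤ} {z : M.carrier} (hz : z ∈ M.deg d) (h : d ≠ e) :
    M.comp e z = 0 :=
  DirectSum.decompose_of_mem_ne M.deg hz h

@[elab_as_elim]
theorem homogeneous_induction {P : M.carrier → Prop}
    (homogeneous : ∀ d, ∀ z ∈ M.deg d, P z) (add : ∀ z w, P z → P w → P (z + w))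
    (z : M.carrier) : P z :=
  DirectSum.Decomposition.inductionOn M.deg (homogeneous 0 0 (zero_mem _))
    (fun {d} z => homogeneous d z z.2) add z

theorem comp_smul {i : ℤ} {r : R k} (hr : r ∈ piece k i) (d : ℤ) (z : M.carrier) :
    M.comp (i + d) (r • z) = r • M.comp d z := by
  induction z using homogeneous_induction with
  | homogeneous e z hz =>
    by_cases h : e = d
    · subst h
      rw [comp_of_mem hz, comp_of_mem (M.smul_mem hr hz)]
    · rw [comp_of_mem_ne hz h, comp_of_mem_ne (M.smul_mem hr hz) (by omega), smul_zero]
  | add z w hz hw => rw [smul_add, map_add, hz, hw, map_add, smul_add]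

theorem comp_smul' {i : ℤ} {r : R k} (hr : r ∈ piece k i) (d : ℤ) (z : M.carrier) :
    M.comp d (r • z) = r • M.comp (d - i) z := by
  rw [← comp_smul hr, add_sub_cancel]

theorem exists_eq_sum_comp (z : M.carrier) : ∃ s : Finset ℤ, (∀ d ∉ s, M.comp d z = 0) ∧
    z = ∑ d ∈ s, M.comp d z := by
  classical
  refine ⟨(DirectSum.decompose M.deg z).support, fun d hd => ?_,
    (DirectSum.sum_support_decompose M.deg z).symm⟩
  rw [DFinsupp.notMem_support_iff] at hd
  rw [comp_apply, hd]; rfl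

theorem eq_zero_of_comp_eq_zero {z : M.carrier} (h : ∀ d, M.comp d z = 0) : z = 0 := by
  obtain ⟨s, -, hs⟩ := exists_eq_sum_comp z
  rw [hs]
  exact Finset.sum_eq_zero fun d _ => h d

theorem algebraMap_smul_mem (c : ℂ) {d : ℤ} {z : M.carrier} (hz : z ∈ M.deg d) :
    algebraMap ℂ (R k) c • z ∈ M.deg d := by
  have := M.smul_mem (algebraMap_mem_piece c) hz
  rwa [zero_add] at this

theorem x_smul_mem {d : ℤ} {z : M.carrier} (hz : z ∈ M.deg d) : xR k • z ∈ M.deg (d + 1) := by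
  rw [add_comm]
  exact M.smul_mem (xR_mem k) hz

theorem y_smul_mem {d : ℤ} {z : M.carrier} (hz : z ∈ M.deg d) : yR k • z ∈ M.deg (d - 1) := by
  rw [sub_eq_add_neg, add_comm]
  exact M.smul_mem (yR_mem k) hz

theorem yR_pow_mem (n : ℕ) : yR k ^ n ∈ piece k (-n) := by
  simpa using SetLike.pow_mem_graded n (yR_mem k)

theorem y_pow_smul_mem (n : ℕ) {d : ℤ} {z : M.carrier} (hz : z ∈ M.deg d) :
    yR k ^ n • z ∈ M.deg (d - n) := by
  rw [sub_eq_add_neg, add_comm]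
  exact M.smul_mem (yR_pow_mem n) hz

theorem algebraMap_zero_smul {N : Type v} [AddCommGroup N] [Module (R k) N] (z : N) :
    algebraMap ℂ (R k) 0 • z = 0 := by
  rw [map_zero, zero_smul_eq]

theorem mem_deg_of_eq {d e : ℤ} {z : M.carrier} (hz : z ∈ M.deg d) (h : d = e) : z ∈ M.deg e :=
  h ▸ hz

/-- The additive map which on `M_d` is given by `f d`. -/
def glue {N : Type v} [AddCommGroup N] (f : ℤ → M.carrier →+ N) : M.carrier →+ N :=
  (DirectSum.toAddMonoid fun d => (f d).comp (M.deg d).subtype).comp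
    (DirectSum.decomposeAddEquiv M.deg).toAddMonoidHom

theorem glue_apply {N : Type v} [AddCommGroup N] (f : ℤ → M.carrier →+ N) {d : ℤ} {z : M.carrier}
    (hz : z ∈ M.deg d) : glue f z = f d z := by
  change DirectSum.toAddMonoid _ (DirectSum.decompose M.deg z) = _
  rw [DirectSum.decompose_of_mem M.deg hz, DirectSum.toAddMonoid_of]
  rfl

end GrMod

theorem GrHom.comp_apply {k : ℕ} {M : GrMod.{u} k} {N : GrMod.{v} k} (f : GrHom M N) (d : ℤ)
    (z : M.carrier) : f.toLin (M.comp d z) = N.comp d (f.toLin z) := by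
  induction z using GrMod.homogeneous_induction with
  | homogeneous e z hz =>
    by_cases h : e = d
    · subst h
      rw [GrMod.comp_of_mem hz, GrMod.comp_of_mem (f.map_deg hz)]
    · rw [GrMod.comp_of_mem_ne hz h, GrMod.comp_of_mem_ne (f.map_deg hz) h, map_zero]
  | add z w hz hw => simp only [map_add, hz, hw]

/-- An injective graded homomorphism reflects degrees. -/
theorem GrHom.mem_deg_of_injective {k : ℕ} {M : GrMod.{u} k} {N : GrMod.{v} k} (f : GrHom M N)
    (hf : Function.Injective f.toLin) {d : ℤ} {z : M.carrier} (hz : f.toLin z ∈ N.deg d) :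
    z ∈ M.deg d := by
  have h : M.comp d z = z := hf (by rw [f.comp_apply, GrMod.comp_of_mem hz])
  rw [← h]
  exact GrMod.comp_mem d z

/-- A surjective graded homomorphism is surjective in every degree. -/
theorem GrHom.exists_mem_deg_of_surjective {k : ℕ} {M : GrMod.{u} k} {N : GrMod.{v} k}
    (f : GrHom M N) (hf : Function.Surjective f.toLin) {d : ℤ} {z : N.carrier} (hz : z ∈ N.deg d) :
    ∃ w ∈ M.deg d, f.toLin w = z := by
  obtain ⟨w, rfl⟩ := hf z
  exact ⟨M.comp d w, GrMod.comp_mem d w, by rw [f.comp_apply, GrMod.comp_of_mem hz]⟩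

/-! ### Charts -/

/-- A chart identifies each homogeneous part `M_d` of a graded module with the ideal `(t ^ (a d))`
of `ℂ[t] / (t ^ k)`, so that `x` acts as multiplication by `t` and `y` acts as the inclusion of
ideals. The elements of `ℂ[t] / (t ^ k)` are given by their coefficient sequences. -/
structure Chart {k : ℕ} (M : GrMod.{u} k) (a : ℤ → ℕ) where
  /-- The coefficients of an element; this is the map `M → M / (y - 1) M`. -/
  coeff : M.carrier →+ (ℕ → ℂ)
  coeff_scalar : ∀ (c : ℂ) z, coeff (algebraMap ℂ (R k) c • z) = c • coeff z
  coeff_x : ∀ z, coeff (xR k • z) = shift k (coeff z)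
  coeff_y : ∀ z, coeff (yR k • z) = coeff z
  eq_zero : ∀ {d z}, z ∈ M.deg d → coeff z = 0 → z = 0
  coeff_apply_eq_zero : ∀ {d z}, z ∈ M.deg d → ∀ j, j < a d ∨ k ≤ j → coeff z j = 0
  exists_coeff_eq : ∀ d v, (∀ j, j < a d ∨ k ≤ j → v j = 0) → ∃ z ∈ M.deg d, coeff z = v

namespace Chart

variable {k : ℕ} {M : GrMod.{u} k} {N : GrMod.{v} k}

theorem ext_of_mem {a : ℤ → ℕ} (κ : Chart M a) {d : ℤ} {z w : M.carrier} (hz : z ∈ M.deg d)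
    (hw : w ∈ M.deg d) (h : κ.coeff z = κ.coeff w) : z = w :=
  sub_eq_zero.1 (κ.eq_zero (sub_mem hz hw) (by rw [map_sub, h, sub_self]))

theorem coeff_y_pow {a : ℤ → ℕ} (κ : Chart M a) (n : ℕ) (z : M.carrier) :
    κ.coeff (yR k ^ n • z) = κ.coeff z := by
  induction n with
  | zero => rw [pow_zero, one_smul]
  | succ n ih => rw [pow_succ', mul_smul, coeff_y, ih]

theorem y_regular {a : ℤ → ℕ} (κ : Chart M a) {z : M.carrier} (h : yR k • z = 0) : z = 0 := by
  refine GrMod.eq_zero_of_comp_eq_zero fun d => κ.eq_zero (GrMod.comp_mem d z) ?_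
  rw [← κ.coeff_y, ← GrMod.comp_smul (yR_mem k), h, map_zero, map_zero]

/-- Charts are transported along isomorphisms. -/
def ofIso {a : ℤ → ℕ} (κ : Chart N a) (e : GrIso M N) : Chart M a where
  coeff := κ.coeff.comp e.toEquiv.toLinearMap.toAddMonoidHom
  coeff_scalar c z := by simpa using κ.coeff_scalar c (e.toEquiv z)
  coeff_x z := by simpa using κ.coeff_x (e.toEquiv z)
  coeff_y z := by simpa using κ.coeff_y (e.toEquiv z)
  eq_zero {d z} hz h := by
    simpa using κ.eq_zero (e.map_deg_iff.2 hz) h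
  coeff_apply_eq_zero {d z} hz := κ.coeff_apply_eq_zero (e.map_deg_iff.2 hz)
  exists_coeff_eq d v hv := by
    obtain ⟨z, hz, h⟩ := κ.exists_coeff_eq d v hv
    refine ⟨e.toEquiv.symm z, ?_, ?_⟩
    · rw [← e.map_deg_iff, LinearEquiv.apply_symm_apply]
      exact hz
    · simpa using h

variable {ℓ : KSubset k} (κ : Chart M (below ℓ.1))

theorem exists_basis {p : ℕ} (hp : p < k) :
    ∃ z ∈ M.deg (ℓ.nth p), κ.coeff z = Pi.single p 1 := by
  refine κ.exists_coeff_eq _ _ fun j hj => Pi.single_eq_of_ne ?_ _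
  rw [KSubset.below_nth hp] at hj
  omega

/-- The homogeneous elements `e_0, …, e_{k-1}` whose degrees are the elements of `ℓ` and whose
coefficient sequences are `1, t, …, t ^ (k-1)`; by convention `e_p = 0` for `p ≥ k`. -/
def basis (p : ℕ) : M.carrier := if h : p < k then (κ.exists_basis h).choose else 0

theorem basis_mem {p : ℕ} (hp : p < k) : κ.basis p ∈ M.deg (ℓ.nth p) := by
  rw [basis, dif_pos hp]
  exact (κ.exists_basis hp).choose_spec.1

theorem coeff_basis {p : ℕ} (hp : p < k) : κ.coeff (κ.basis p) = Pi.single p 1 := by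
  rw [basis, dif_pos hp]
  exact (κ.exists_basis hp).choose_spec.2

theorem basis_of_le {p : ℕ} (hp : k ≤ p) : κ.basis p = 0 := by
  rw [basis, dif_neg (by omega)]

end Chart

/-- The exponent of `y` in the relation `x e_p = y ^ _ e_{p+1}`. -/
def KSubset.gap {k : ℕ} (ℓ : KSubset k) (p : ℕ) : ℕ := (ℓ.nth (p + 1) - ℓ.nth p - 1).toNat

theorem KSubset.gap_eq {k : ℕ} {ℓ : KSubset k} {p : ℕ} (hp : p + 1 < k) :
    (ℓ.gap p : ℤ) = ℓ.nth (p + 1) - ℓ.nth p - 1 := by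
  have := nth_lt_nth (ℓ := ℓ) hp
  rw [gap]
  omega

theorem KSubset.y_pow_gap_smul_mem {k : ℕ} {ℓ : KSubset k} {M : GrMod.{u} k} {p : ℕ}
    {z : M.carrier} (hz : p + 1 < k → z ∈ M.deg (ℓ.nth (p + 1))) (h0 : k ≤ p + 1 → z = 0) :
    yR k ^ ℓ.gap p • z ∈ M.deg (ℓ.nth p + 1) := by
  by_cases h : p + 1 < k
  · refine GrMod.mem_deg_of_eq (GrMod.y_pow_smul_mem _ (hz h)) ?_
    rw [gap_eq h]
    ring
  · rw [h0 (by omega), smul_zero]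
    exact zero_mem _

namespace Chart

variable {k : ℕ} {M : GrMod.{u} k} {N : GrMod.{v} k} {ℓ : KSubset k} (κ : Chart M (below ℓ.1))

theorem x_smul_basis {p : ℕ} (hp : p < k) :
    xR k • κ.basis p = yR k ^ ℓ.gap p • κ.basis (p + 1) := by
  refine κ.ext_of_mem (GrMod.x_smul_mem (κ.basis_mem hp))
    (KSubset.y_pow_gap_smul_mem κ.basis_mem κ.basis_of_le) ?_
  rw [κ.coeff_x, κ.coeff_y_pow, κ.coeff_basis hp]
  ext j
  rw [shift_apply]
  by_cases h : p + 1 < k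
  · rw [κ.coeff_basis h, Pi.single_apply, Pi.single_apply]
    split_ifs <;> first | rfl | omega
  · rw [κ.basis_of_le (by omega), map_zero, Pi.zero_apply, ite_eq_right_iff]
    exact fun hj => Pi.single_eq_of_ne (by omega) _

/-- The map which on `M_d` sends `y ^ (deg e_p - d) e_p` to `y ^ (deg e_p - d) ε_p`. -/
def liftDeg (ε : ℕ → N.carrier) (d : ℤ) : M.carrier →+ N.carrier where
  toFun z := ∑ p ∈ Finset.range k,
    algebraMap ℂ (R k) (κ.coeff z p) • yR k ^ (ℓ.nth p - d).toNat • ε p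
  map_zero' := Finset.sum_eq_zero fun p _ => by
    rw [map_zero, Pi.zero_apply, GrMod.algebraMap_zero_smul]
  map_add' z w := by
    rw [← Finset.sum_add_distrib]
    refine Finset.sum_congr rfl fun p _ => ?_
    rw [map_add, Pi.add_apply, map_add, add_smul]

theorem liftDeg_apply (ε : ℕ → N.carrier) (d : ℤ) (z : M.carrier) :
    κ.liftDeg ε d z = ∑ p ∈ Finset.range k,
      algebraMap ℂ (R k) (κ.coeff z p) • yR k ^ (ℓ.nth p - d).toNat • ε p := rfl

theorem coeff_eq_zero_or_le {d : ℤ} {z : M.carrier} (hz : z ∈ M.deg d) {p : ℕ} (hp : p < k) :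
    κ.coeff z p = 0 ∨ d ≤ ℓ.nth p := by
  by_cases h : p < below ℓ.1 d
  · exact Or.inl (κ.coeff_apply_eq_zero hz p (Or.inl h))
  · exact Or.inr ((KSubset.le_nth_iff hp).2 (not_lt.1 h))

theorem liftDeg_mem {ε : ℕ → N.carrier} (hε : ∀ p < k, ε p ∈ N.deg (ℓ.nth p)) {d : ℤ}
    {z : M.carrier} (hz : z ∈ M.deg d) : κ.liftDeg ε d z ∈ N.deg d := by
  rw [liftDeg_apply]
  refine sum_mem fun p hp => ?_
  have hp := Finset.mem_range.1 hp
  rcases κ.coeff_eq_zero_or_le hz hp with h | h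
  · rw [h, GrMod.algebraMap_zero_smul]
    exact zero_mem _
  · exact GrMod.algebraMap_smul_mem _
      (GrMod.mem_deg_of_eq (GrMod.y_pow_smul_mem _ (hε p hp)) (by omega))

theorem liftDeg_scalar (ε : ℕ → N.carrier) (d : ℤ) (c : ℂ) (z : M.carrier) :
    κ.liftDeg ε d (algebraMap ℂ (R k) c • z) = algebraMap ℂ (R k) c • κ.liftDeg ε d z := by
  rw [liftDeg_apply, liftDeg_apply, Finset.smul_sum]
  refine Finset.sum_congr rfl fun p _ => ?_
  rw [κ.coeff_scalar, Pi.smul_apply, smul_eq_mul, map_mul, mul_smul]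

theorem liftDeg_y (ε : ℕ → N.carrier) {d : ℤ} {z : M.carrier} (hz : z ∈ M.deg d) :
    κ.liftDeg ε (d - 1) (yR k • z) = yR k • κ.liftDeg ε d z := by
  rw [liftDeg_apply, liftDeg_apply, Finset.smul_sum]
  refine Finset.sum_congr rfl fun p hp => ?_
  rw [κ.coeff_y]
  rcases κ.coeff_eq_zero_or_le hz (Finset.mem_range.1 hp) with h | h
  · rw [h, GrMod.algebraMap_zero_smul, GrMod.algebraMap_zero_smul, smul_zero]
  · rw [smul_comm (yR k), ← mul_smul (yR k), ← pow_succ',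
      show (ℓ.nth p - (d - 1)).toNat = (ℓ.nth p - d).toNat + 1 by omega]

theorem liftDeg_x {ε : ℕ → N.carrier} (hε : ∀ p < k, xR k • ε p = yR k ^ ℓ.gap p • ε (p + 1))
    (h0 : ε k = 0) {d : ℤ} {z : M.carrier} (hz : z ∈ M.deg d) :
    κ.liftDeg ε (d + 1) (xR k • z) = xR k • κ.liftDeg ε d z := by
  set h : ℕ → N.carrier := fun p => algebraMap ℂ (R k) (if 0 < p then κ.coeff z (p - 1) else 0) •
    yR k ^ (ℓ.nth p - (d + 1)).toNat • ε p with hh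
  have h1 : κ.liftDeg ε (d + 1) (xR k • z) = ∑ p ∈ Finset.range k, h p := by
    rw [liftDeg_apply]
    refine Finset.sum_congr rfl fun p hp => ?_
    rw [κ.coeff_x, shift_apply, hh]
    simp only [Finset.mem_range.1 hp, and_true]
  have h2 : xR k • κ.liftDeg ε d z = ∑ p ∈ Finset.range k, h (p + 1) := by
    rw [liftDeg_apply, Finset.smul_sum]
    refine Finset.sum_congr rfl fun p hp => ?_
    have hp := Finset.mem_range.1 hp
    rw [smul_comm (xR k), smul_comm (xR k), hε p hp, hh]
    simp only [Nat.zero_lt_succ, if_true, Nat.add_sub_cancel]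
    rcases κ.coeff_eq_zero_or_le hz hp with h3 | h3
    · rw [h3, GrMod.algebraMap_zero_smul, GrMod.algebraMap_zero_smul]
    · by_cases hp' : p + 1 < k
      · have := KSubset.gap_eq (ℓ := ℓ) hp'
        rw [← mul_smul (yR k ^ _), ← pow_add,
          show (ℓ.nth p - d).toNat + ℓ.gap p = (ℓ.nth (p + 1) - (d + 1)).toNat by omega]
      · rw [show p + 1 = k by omega, h0]
        simp only [smul_zero]
  rw [h1, h2]
  have h3 := Finset.sum_range_succ h k
  have hh0 : h 0 = 0 := by
    rw [hh]
    exact GrMod.algebraMap_zero_smul _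
  have hhk : h k = 0 := by
    rw [hh]
    simp only [h0, smul_zero]
  rw [Finset.sum_range_succ', hh0, hhk, add_zero, add_zero] at h3
  exact h3.symm

/-- Elements `ε_p` that satisfy the same relations as the `e_p` define a homomorphism. -/
def lift (ε : ℕ → N.carrier) (hmem : ∀ p < k, ε p ∈ N.deg (ℓ.nth p))
    (hx : ∀ p < k, xR k • ε p = yR k ^ ℓ.gap p • ε (p + 1)) (h0 : ε k = 0) : GrHom M N where
  toLin := linearMapOfGenerators (GrMod.glue (κ.liftDeg ε))
    (fun c z => by
      induction z using GrMod.homogeneous_induction with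
      | homogeneous d z hz =>
        rw [GrMod.glue_apply _ hz, GrMod.glue_apply _ (GrMod.algebraMap_smul_mem c hz),
          liftDeg_scalar]
      | add z w hz hw => simp only [smul_add, map_add, hz, hw])
    (fun z => by
      induction z using GrMod.homogeneous_induction with
      | homogeneous d z hz =>
        rw [GrMod.glue_apply _ hz, GrMod.glue_apply _ (GrMod.x_smul_mem hz),
          κ.liftDeg_x hx h0 hz]
      | add z w hz hw => simp only [smul_add, map_add, hz, hw])
    (fun z => by
      induction z using GrMod.homogeneous_induction with
      | homogeneous d z hz =>
        rw [GrMod.glue_apply _ hz, GrMod.glue_apply _ (GrMod.y_smul_mem hz), κ.liftDeg_y ε hz]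
      | add z w hz hw => simp only [smul_add, map_add, hz, hw])
  map_deg {d z} hz := by
    change GrMod.glue (κ.liftDeg ε) z ∈ _
    rw [GrMod.glue_apply _ hz]
    exact κ.liftDeg_mem hmem hz

theorem lift_apply {ε : ℕ → N.carrier} (hmem : ∀ p < k, ε p ∈ N.deg (ℓ.nth p))
    (hx : ∀ p < k, xR k • ε p = yR k ^ ℓ.gap p • ε (p + 1)) (h0 : ε k = 0) {d : ℤ}
    {z : M.carrier} (hz : z ∈ M.deg d) :
    (κ.lift ε hmem hx h0).toLin z = ∑ p ∈ Finset.range k,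
      algebraMap ℂ (R k) (κ.coeff z p) • yR k ^ (ℓ.nth p - d).toNat • ε p :=
  GrMod.glue_apply _ hz

/-- The coefficients of `∑ c_p y ^ _ e_p` are the `c_p`. -/
theorem coeff_sum_basis {c : ℕ → ℂ} (hc : ∀ j, k ≤ j → c j = 0) (n : ℕ → ℕ) :
    κ.coeff (∑ p ∈ Finset.range k, algebraMap ℂ (R k) (c p) • yR k ^ n p • κ.basis p) = c := by
  ext j
  rw [map_sum, Finset.sum_apply]
  by_cases hj : j < k
  · rw [Finset.sum_eq_single j]
    · rw [κ.coeff_scalar, κ.coeff_y_pow, κ.coeff_basis hj, Pi.smul_apply, Pi.single_eq_same,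
        smul_eq_mul, mul_one]
    · intro p hp hpj
      rw [κ.coeff_scalar, κ.coeff_y_pow, κ.coeff_basis (Finset.mem_range.1 hp), Pi.smul_apply,
        Pi.single_eq_of_ne hpj.symm, smul_zero]
    · exact fun h => absurd (Finset.mem_range.2 hj) h
  · rw [hc j (by omega)]
    refine Finset.sum_eq_zero fun p hp => ?_
    have := Finset.mem_range.1 hp
    rw [κ.coeff_scalar, κ.coeff_y_pow, κ.coeff_basis this, Pi.smul_apply,
      Pi.single_eq_of_ne (by omega), smul_zero]

/-- The homomorphism between two modules with charts of the same type. -/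
def map (κ' : Chart N (below ℓ.1)) : GrHom M N :=
  κ.lift κ'.basis (fun _ => κ'.basis_mem) (fun _ => κ'.x_smul_basis) (κ'.basis_of_le le_rfl)

theorem coeff_map (κ' : Chart N (below ℓ.1)) {d : ℤ} {z : M.carrier} (hz : z ∈ M.deg d) :
    κ'.coeff ((κ.map κ').toLin z) = κ.coeff z := by
  rw [map, lift_apply _ _ _ _ hz, coeff_sum_basis]
  exact fun j hj => κ.coeff_apply_eq_zero hz j (Or.inr hj)

theorem map_map (κ' : Chart N (below ℓ.1)) (z : M.carrier) :
    (κ'.map κ).toLin ((κ.map κ').toLin z) = z := by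
  induction z using GrMod.homogeneous_induction with
  | homogeneous d z hz =>
    have h := (κ.map κ').map_deg hz
    refine κ.ext_of_mem ((κ'.map κ).map_deg h) hz ?_
    rw [coeff_map _ _ h, coeff_map _ _ hz]
  | add z w hz hw => rw [map_add, map_add, hz, hw]

/-- Two modules with charts of the same type are isomorphic. -/
def iso (κ' : Chart N (below ℓ.1)) : GrIso M N where
  toEquiv := LinearEquiv.ofLinearMap (κ.map κ').toLin (κ'.map κ).toLin
    (LinearMap.ext fun z => κ'.map_map κ z) (LinearMap.ext fun z => κ.map_map κ' z)
  map_deg_iff {d z} := by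
    refine ⟨fun h => ?_, fun h => (κ.map κ').map_deg h⟩
    have h1 := (κ'.map κ).map_deg h
    rwa [LinearEquiv.coe_ofLinearMap, map_map] at h1

/-- The elements of `ℓ` are the degrees in which `M / y M` does not vanish. -/
theorem mem_iff (κ : Chart M (below ℓ.1)) (d : ℤ) :
    d ∈ ℓ.1 ↔ ∃ z ∈ M.deg d, ∀ w ∈ M.deg (d + 1), yR k • w ≠ z := by
  have hd := below_add_one ℓ.1 d
  constructor
  · intro h
    rw [if_pos h] at hd
    obtain ⟨z, hz, h1⟩ := κ.exists_coeff_eq d (Pi.single (below ℓ.1 d) 1) fun j hj =>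
      Pi.single_eq_of_ne (by have := KSubset.below_le (ℓ := ℓ) (d + 1); omega) _
    refine ⟨z, hz, fun w hw hwz => ?_⟩
    have h2 := κ.coeff_apply_eq_zero hw (below ℓ.1 d) (Or.inl (by omega))
    rw [← κ.coeff_y, hwz, h1, Pi.single_eq_same] at h2
    exact one_ne_zero h2
  · rintro ⟨z, hz, h⟩
    by_contra hdℓ
    rw [if_neg hdℓ, add_zero] at hd
    obtain ⟨w, hw, h1⟩ := κ.exists_coeff_eq (d + 1) (κ.coeff z) fun j hj =>
      κ.coeff_apply_eq_zero hz j (by rwa [hd] at hj)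
    refine h w hw (κ.ext_of_mem (GrMod.mem_deg_of_eq (GrMod.y_smul_mem hw) (by ring)) hz ?_)
    rw [κ.coeff_y, h1]

theorem unique {ℓ' : KSubset k} (κ : Chart M (below ℓ.1)) (κ' : Chart M (below ℓ'.1)) :
    ℓ = ℓ' :=
  Subtype.ext (Finset.ext fun d => (κ.mem_iff d).trans (κ'.mem_iff d).symm)

end Chart

/-! ### Maximal Cohen--Macaulay modules are those on which `y` is injective -/

section CohenMacaulay

variable {k : ℕ}

theorem height_le_one (p : Ideal (R k)) [p.IsPrime] : p.height ≤ 1 := by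
  have h1 : ringKrullDim (R k) + 1 ≤ ringKrullDim Poly :=
    ringKrullDim_quotient_succ_le_of_nonZeroDivisor
      (mem_nonZeroDivisors_of_ne_zero (pow_ne_zero k (MvPolynomial.X_ne_zero 0)))
  rw [MvPolynomial.ringKrullDim_of_isNoetherianRing, ringKrullDim_eq_zero_of_field, zero_add,
    Nat.card_fin] at h1
  have h2 : ((p.height + 1 : ℕ∞) : WithBot ℕ∞) ≤ ((2 : ℕ∞) : WithBot ℕ∞) := by
    push_cast
    exact (add_le_add_left (Ideal.height_le_ringKrullDim_of_isPrime (I := p)) 1).trans h1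
  have h3 : p.height + 1 ≤ 1 + 1 := by
    rw [one_add_one_eq_two]
    exact WithBot.coe_le_coe.1 h2
  exact (ENat.add_le_add_iff_right ENat.one_ne_top).1 h3

theorem xR_mem_of_isPrime (p : Ideal (R k)) [hp : p.IsPrime] : xR k ∈ p :=
  hp.mem_of_pow_mem k (by rw [xR_pow_eq_zero]; exact zero_mem p)

theorem exists_eq_aeval_yR_add (r : R k) :
    ∃ (G : Polynomial ℂ) (s : R k), r = Polynomial.aeval (yR k) G + xR k * s := by
  induction r using R_induction with
  | scalar c => exact ⟨Polynomial.C c, 0, by simp⟩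
  | x => exact ⟨0, 1, by simp⟩
  | y => exact ⟨Polynomial.X, 0, by simp⟩
  | add r s hr hs =>
    obtain ⟨G, a, rfl⟩ := hr
    obtain ⟨H, b, rfl⟩ := hs
    exact ⟨G + H, a + b, by rw [map_add]; ring⟩
  | mul r s hr hs =>
    obtain ⟨G, a, rfl⟩ := hr
    obtain ⟨H, b, rfl⟩ := hs
    exact ⟨G * H, Polynomial.aeval (yR k) G * b + a * (Polynomial.aeval (yR k) H + xR k * b),
      by rw [map_mul]; ring⟩

/-- A prime ideal of positive height contains a nonzero polynomial in `y`. -/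
theorem exists_aeval_yR_mem {p : Ideal (R k)} [p.IsPrime] (hp : p.height ≠ 0) :
    ∃ G : Polynomial ℂ, G ≠ 0 ∧ Polynomial.aeval (yR k) G ∈ p := by
  obtain ⟨q, hq, hqp⟩ := Ideal.exists_minimalPrimes_le (bot_le : (⊥ : Ideal (R k)) ≤ p)
  have : q.IsPrime := hq.1.1
  have hne : ¬ p ≤ q := by
    intro h
    rw [Ne, Ideal.height_eq_zero_iff] at hp
    exact hp (le_antisymm h hqp ▸ hq)
  obtain ⟨r, hr, hrq⟩ := SetLike.not_le_iff_exists.1 hne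
  obtain ⟨G, s, rfl⟩ := exists_eq_aeval_yR_add r
  refine ⟨G, ?_, ?_⟩
  · rintro rfl
    rw [map_zero, zero_add] at hrq
    exact hrq (q.mul_mem_right s (xR_mem_of_isPrime q))
  · exact (Ideal.add_mem_iff_left p (p.mul_mem_right s (xR_mem_of_isPrime p))).1 hr

theorem GrMod.y_pow_regular {M : GrMod.{u} k} (hy : ∀ z : M.carrier, yR k • z = 0 → z = 0) (n : ℕ) :
    ∀ z : M.carrier, yR k ^ n • z = 0 → z = 0 := by
  induction n with
  | zero => simp
  | succ n ih => exact fun z hz => ih z (hy _ (by rwa [← mul_smul, ← pow_succ']))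

theorem GrMod.aeval_yR_regular {M : GrMod.{u} k} (hy : ∀ z : M.carrier, yR k • z = 0 → z = 0)
    {G : Polynomial ℂ} (hG : G ≠ 0) (z : M.carrier) (h : Polynomial.aeval (yR k) G • z = 0) :
    z = 0 := by
  classical
  by_contra hz
  obtain ⟨s, hs, hsum⟩ := exists_eq_sum_comp z
  have hne : (s.filter fun d => M.comp d z ≠ 0).Nonempty := by
    by_contra hempty
    rw [Finset.not_nonempty_iff_eq_empty, Finset.filter_eq_empty_iff] at hempty
    exact hz (hsum.trans (Finset.sum_eq_zero fun d hd => not_not.1 (hempty hd)))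
  -- the component of lowest degree of `G(y) z` comes from the lowest term of `G` in the top
  -- degree component of `z`
  set D := (s.filter fun d => M.comp d z ≠ 0).max' hne with hD
  have hDne : M.comp D z ≠ 0 := (Finset.mem_filter.1 (Finset.max'_mem _ hne)).2
  have hmax : ∀ e, D < e → M.comp e z = 0 := by
    intro e he
    by_contra h1
    have h2 : e ∈ s := by
      by_contra h3
      exact h1 (hs e h3)
    have := Finset.le_max' (s.filter fun d => M.comp d z ≠ 0) e (Finset.mem_filter.2 ⟨h2, h1⟩)
    omega
  set n := G.natTrailingDegree with hn
  have h1 : M.comp (D - n) (Polynomial.aeval (yR k) G • z) =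
      algebraMap ℂ (R k) (G.coeff n) • yR k ^ n • M.comp D z := by
    rw [Polynomial.aeval_eq_sum_range, Finset.sum_smul, map_sum, Finset.sum_eq_single n]
    · rw [Algebra.smul_def, mul_smul,
        comp_smul' (algebraMap_mem_piece _), comp_smul' (yR_pow_mem n)]
      rw [show D - n - 0 - -(n : ℤ) = D by ring]
    · intro i _ hi
      rw [Algebra.smul_def, mul_smul,
        comp_smul' (algebraMap_mem_piece _), comp_smul' (yR_pow_mem i)]
      rcases lt_or_gt_of_ne hi with h2 | h2
      · rw [Polynomial.coeff_eq_zero_of_lt_natTrailingDegree h2, algebraMap_zero_smul]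
      · rw [hmax _ (by omega), smul_zero, smul_zero]
    · intro h2
      rw [Finset.mem_range, not_lt] at h2
      exact absurd (Polynomial.natTrailingDegree_le_natDegree G) (by omega)
  rw [h, map_zero] at h1
  have hc : G.coeff n ≠ 0 := Polynomial.trailingCoeff_nonzero_iff_nonzero.2 hG
  have h2 : yR k ^ n • M.comp D z = 0 := by
    have h3 := congrArg (fun w => algebraMap ℂ (R k) (G.coeff n)⁻¹ • w) h1
    simp only [smul_zero] at h3
    rw [← mul_smul, ← map_mul, inv_mul_cancel₀ hc, map_one, one_smul] at h3
    exact h3.symm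
  exact hDne (y_pow_regular hy n _ h2)

theorem localDepth_le (A : Type v) (N : Type u) [CommRing A] [IsLocalRing A] [IsNoetherianRing A]
    [AddCommGroup N] [Module A N] [Module.Finite A N] :
    (localDepth A N : WithBot ℕ∞) ≤ ringKrullDim A := by
  obtain ⟨n, hn⟩ : ∃ n : ℕ∞, ringKrullDim A = n :=
    ⟨_, (IsLocalRing.maximalIdeal_height_eq_ringKrullDim (R := A)).symm⟩
  rw [hn, WithBot.coe_le_coe, localDepth]
  refine iSup₂_le fun rs hrs => ?_
  have h1 := Module.supportDim_add_length_eq_supportDim_of_isRegular rs hrs.2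
  have h2 := (h1.trans_le (Module.supportDim_le_ringKrullDim A N)).trans_eq hn
  have h3 : Nontrivial (N ⧸ Ideal.ofList rs • (⊤ : Submodule A N)) :=
    hrs.2.quot_ofList_smul_nontrivial ⊤
  have h4 : (0 : WithBot ℕ∞) ≤ Module.supportDim A (N ⧸ Ideal.ofList rs • (⊤ : Submodule A N)) := by
    have := (Module.supportDim_ne_bot_iff_nontrivial A
      (N ⧸ Ideal.ofList rs • (⊤ : Submodule A N))).2 h3
    obtain ⟨m, hm⟩ := WithBot.ne_bot_iff_exists.1 this
    rw [← hm]
    exact WithBot.coe_le_coe.2 bot_le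
  have h5 : ((rs.length : ℕ∞) : WithBot ℕ∞) ≤ (n : WithBot ℕ∞) := by
    refine le_trans ?_ h2
    exact le_add_of_nonneg_left h4
  exact WithBot.coe_le_coe.1 h5

/-- If `y` is injective on a finitely generated graded module, the module is maximal
Cohen--Macaulay: at a prime of height one, some polynomial in `y` is a regular element. -/
theorem GrMod.isMCM_of_y_regular {M : GrMod.{u} k} (hy : ∀ z : M.carrier, yR k • z = 0 → z = 0) :
    M.IsMCM := by
  refine ⟨M.finite, fun p hp => ?_⟩
  rcases subsingleton_or_nontrivial (LocalizedModule p.primeCompl M.carrier) with h | h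
  · exact Or.inl h
  refine Or.inr (le_antisymm (localDepth_le _ _) ?_)
  rw [IsLocalization.AtPrime.ringKrullDim_eq_height p, WithBot.coe_le_coe]
  by_cases h0 : p.height = 0
  · rw [h0]
    exact bot_le
  refine (height_le_one p).trans ?_
  obtain ⟨G, hG, hGp⟩ := exists_aeval_yR_mem h0
  have h1 : IsSMulRegular M.carrier (Polynomial.aeval (yR k) G) :=
    (isSMulRegular_iff_right_eq_zero_of_smul).2 fun z hz => aeval_yR_regular hy hG z hz
  have h2 := h1.of_isLocalizedModule (Localization.AtPrime p) p.primeCompl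
    (LocalizedModule.mkLinearMap p.primeCompl M.carrier)
  set g := algebraMap (R k) (Localization.AtPrime p) (Polynomial.aeval (yR k) G) with hg
  have hgm : g ∈ IsLocalRing.maximalIdeal (Localization.AtPrime p) :=
    (IsLocalization.AtPrime.to_map_mem_maximal_iff _ p _).2 hGp
  have hmem : ∀ r ∈ [g], r ∈ IsLocalRing.maximalIdeal (Localization.AtPrime p) := by
    simpa using hgm
  have h3 : RingTheory.Sequence.IsRegular (LocalizedModule p.primeCompl M.carrier) [g] :=
    (IsLocalRing.isRegular_iff_isWeaklyRegular_of_subset_maximalIdeal hmem).2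
      ((RingTheory.Sequence.isWeaklyRegular_singleton_iff _ g).2 h2)
  exact le_iSup₂_of_le [g] ⟨hmem, h3⟩ (by simp)

/-- Evaluation at the origin. -/
def evalZero (hk : 0 < k) : R k →ₐ[ℂ] ℂ :=
  Ideal.Quotient.liftₐ (relIdeal k) (MvPolynomial.aeval fun _ => (0 : ℂ)) fun f hf => by
    obtain ⟨g, rfl⟩ := Ideal.mem_span_singleton.1 hf
    simp [hk.ne']

/-- Evaluation at `x = 0`. -/
def evalX (hk : 0 < k) : R k →ₐ[ℂ] Polynomial ℂ :=
  Ideal.Quotient.liftₐ (relIdeal k)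
    (MvPolynomial.aeval (![0, Polynomial.X] : Fin 2 → Polynomial ℂ)) fun f hf => by
      obtain ⟨g, rfl⟩ := Ideal.mem_span_singleton.1 hf
      simp [hk.ne']

theorem evalZero_x (hk : 0 < k) : evalZero hk (xR k) = 0 :=
  (MvPolynomial.aeval_X _ _)

theorem evalZero_y (hk : 0 < k) : evalZero hk (yR k) = 0 :=
  (MvPolynomial.aeval_X _ _)

theorem evalX_x (hk : 0 < k) : evalX hk (xR k) = 0 :=
  (MvPolynomial.aeval_X _ _)

theorem evalX_y (hk : 0 < k) : evalX hk (yR k) = Polynomial.X :=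
  (MvPolynomial.aeval_X _ _)

/-- The maximal ideal `(x, y)`. -/
abbrev origin (hk : 0 < k) : Ideal (R k) := RingHom.ker (evalZero hk)

instance origin_isPrime (hk : 0 < k) : (origin hk).IsPrime := RingHom.ker_isPrime _

theorem one_le_height_origin (hk : 0 < k) : 1 ≤ (origin hk).height := by
  have hlt : RingHom.ker (evalX hk) < origin hk := by
    refine SetLike.lt_iff_le_and_exists.2 ⟨fun r hr => ?_, yR k, evalZero_y hk, fun h => ?_⟩
    · obtain ⟨G, s, rfl⟩ := exists_eq_aeval_yR_add r
      rw [RingHom.mem_ker, map_add, map_mul, evalX_x, zero_mul, add_zero,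
        ← Polynomial.aeval_algHom_apply, evalX_y, Polynomial.aeval_X_left_apply] at hr
      rw [RingHom.mem_ker, hr, map_zero, zero_add, map_mul, evalZero_x, zero_mul]
    · rw [RingHom.mem_ker, evalX_y] at h
      exact Polynomial.X_ne_zero h
  have : (RingHom.ker (evalX hk)).IsPrime := RingHom.ker_isPrime _
  have h := Ideal.height_add_one_le_of_lt_of_isPrime hlt
  exact le_trans le_add_self h

/-- `y` is injective on a graded maximal Cohen--Macaulay module: otherwise there is a nonzero
element that is killed by `x` and `y`, so that the depth at the origin is zero. -/
theorem GrMod.IsMCM.y_regular (hk : 0 < k) {M : GrMod.{u} k} (hM : M.IsMCM) (z : M.carrier)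
    (hz : yR k • z = 0) : z = 0 := by
  by_contra hz0
  obtain ⟨w, hw0, hxw, hyw⟩ : ∃ w : M.carrier, w ≠ 0 ∧ xR k • w = 0 ∧ yR k • w = 0 := by
    classical
    have hex : ∃ j, xR k ^ j • z = 0 := ⟨k, by rw [xR_pow_eq_zero, zero_smul_eq]⟩
    obtain ⟨j, hj⟩ : ∃ j, Nat.find hex = j + 1 := Nat.exists_eq_succ_of_ne_zero fun h => by
      have := Nat.find_spec hex
      rw [h, pow_zero, one_smul] at this
      exact hz0 this
    refine ⟨xR k ^ j • z, Nat.find_min hex (by omega), ?_, by rw [smul_comm, hz, smul_zero]⟩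
    rw [← mul_smul, ← pow_succ', ← hj]
    exact Nat.find_spec hex
  have hact : ∀ r : R k, r • w = algebraMap ℂ (R k) (evalZero hk r) • w := by
    intro r
    induction r using R_induction with
    | scalar c => rw [AlgHom.commutes]; rfl
    | x => rw [hxw, evalZero_x, algebraMap_zero_smul]
    | y => rw [hyw, evalZero_y, algebraMap_zero_smul]
    | add r s hr hs => rw [map_add, map_add, add_smul, add_smul, ← hr, ← hs]
    | mul r s hr hs => rw [map_mul, map_mul, mul_smul, mul_smul, ← hs, smul_comm, hr, smul_comm]
  have hw : LocalizedModule.mk w (1 : (origin hk).primeCompl) ≠ 0 := by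
    intro h
    rw [← LocalizedModule.zero_mk 1, LocalizedModule.mk_eq] at h
    obtain ⟨s, hs⟩ := h
    rw [smul_zero, smul_zero, one_smul, Submonoid.smul_def, hact] at hs
    have hs0 : evalZero hk (s : R k) ≠ 0 := s.2
    refine hw0 ?_
    rw [← one_smul (R k) w, ← map_one (algebraMap ℂ (R k)), ← inv_mul_cancel₀ hs0, map_mul,
      mul_smul, hs, smul_zero]
  rcases hM.2 (origin hk) with h | h
  · exact hw (Subsingleton.elim _ _)
  rw [IsLocalization.AtPrime.ringKrullDim_eq_height (origin hk), WithBot.coe_inj] at h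
  have h1 := one_le_height_origin hk
  rw [← h, localDepth] at h1
  refine absurd h1 (not_le.2 (lt_of_le_of_lt (iSup₂_le fun rs hrs => ?_) zero_lt_one))
  rcases rs with _ | ⟨r, rs⟩
  · simp
  exfalso
  have hreg := ((RingTheory.Sequence.isRegular_cons_iff _ _ _).1 hrs.2).1
  have hrm := hrs.1 r (by simp)
  obtain ⟨a, s, rfl⟩ := IsLocalization.exists_mk'_eq (origin hk).primeCompl r
  rw [IsLocalization.AtPrime.mk'_mem_maximal_iff _ (origin hk), RingHom.mem_ker] at hrm
  refine hw ((isSMulRegular_iff_right_eq_zero_of_smul).1 hreg _ ?_)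
  rw [← Localization.mk_eq_mk', LocalizedModule.mk_smul_mk, hact, hrm, algebraMap_zero_smul,
    LocalizedModule.zero_mk]

end CohenMacaulay

/-! ### Ideals of `ℂ[t] / (t ^ k)` -/

section ShiftInvariant

variable {k : ℕ}

theorem exists_mem_of_shift_mem {W : Submodule ℂ (ℕ → ℂ)} (hW : ∀ v ∈ W, shift k v ∈ W)
    {v : ℕ → ℂ} (hv : v ∈ W) {a : ℕ} (ha : ∀ i < a, v i = 0) (n : ℕ) (hn : a + n < k) :
    ∃ u ∈ W, (∀ i < a + n, u i = 0) ∧ u (a + n) = v a := by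
  induction n with
  | zero => exact ⟨v, hv, ha, rfl⟩
  | succ n ih =>
    obtain ⟨u, hu, h1, h2⟩ := ih (by omega)
    refine ⟨shift k u, hW u hu, fun i hi => ?_, ?_⟩
    · rcases i with _ | i
      · exact shift_zero k u
      · rw [shift_succ _ (by omega)]
        exact h1 i (by omega)
    · rw [← add_assoc, shift_succ _ (by omega), h2]

/-- A shift-invariant subspace of `ℂ[t] / (t ^ k)` is one of the ideals `(t ^ a)`. -/
theorem exists_eq_of_shift_mem {W : Submodule ℂ (ℕ → ℂ)} (hW : ∀ v ∈ W, shift k v ∈ W)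
    (hk : ∀ v ∈ W, ∀ j, k ≤ j → v j = 0) :
    ∃ a ≤ k, ∀ v, v ∈ W ↔ ∀ j, j < a ∨ k ≤ j → v j = 0 := by
  classical
  by_cases hex : ∃ j, ∃ v ∈ W, v j ≠ 0
  · obtain ⟨v, hv, hva⟩ := Nat.find_spec hex
    have hmin : ∀ w ∈ W, ∀ j < Nat.find hex, w j = 0 := fun w hw j hj => by
      by_contra h
      exact Nat.find_min hex hj ⟨w, hw, h⟩
    have hak : Nat.find hex < k := by
      by_contra h
      exact hva (hk v hv _ (not_lt.1 h))
    generalize Nat.find hex = a at *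
    refine ⟨a, hak.le, fun w => ⟨fun hw j hj => hj.elim (hmin w hw j) (hk w hw j), ?_⟩⟩
    have key : ∀ n j, n + j = k → a ≤ j → ∀ w : ℕ → ℂ, (∀ i, i < j ∨ k ≤ i → w i = 0) → w ∈ W := by
      intro n
      induction n with
      | zero =>
        intro j hj _ w hw
        rw [show w = 0 from funext fun i => hw i (by omega)]
        exact W.zero_mem
      | succ n ih =>
        intro j hj haj w hw
        obtain ⟨u, hu, hu0, hu1⟩ := exists_mem_of_shift_mem hW hv (hmin v hv) (j - a) (by omega)
        rw [Nat.add_sub_cancel' haj] at hu0 hu1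
        have h1 : w - (w j / v a) • u ∈ W := by
          refine ih (j + 1) (by omega) (by omega) _ fun i hi => ?_
          rw [Pi.sub_apply, Pi.smul_apply, smul_eq_mul]
          by_cases hij : i = j
          · rw [hij, hu1, div_mul_cancel₀ _ hva, sub_self]
          · rcases hi with hi | hi
            · rw [hw i (by omega), hu0 i (by omega), mul_zero, sub_zero]
            · rw [hw i (by omega), hk u hu i hi, mul_zero, sub_zero]
        have := W.add_mem h1 (W.smul_mem (w j / v a) hu)
        rwa [sub_add_cancel] at this
    exact key (k - a) a (by omega) le_rfl w
  · push Not at hex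
    refine ⟨k, le_rfl, fun v => ⟨fun hv j _ => hex j v hv, fun h => ?_⟩⟩
    rw [show v = 0 from funext fun j => h j (by omega)]
    exact W.zero_mem

end ShiftInvariant

/-! ### Charts of generically free modules of rank one -/

/-- A function that grows from `0` to `k` by steps of size at most `1` counts a `k`-subset. -/
theorem exists_below_eq {k : ℕ} (a : ℤ → ℕ) (h1 : ∀ d, a d ≤ a (d + 1))
    (h2 : ∀ d, a (d + 1) ≤ a d + 1) {A B : ℤ} (hA : ∀ d ≤ A, a d = 0) (hB : ∀ d ≥ B, a d = k) :
    ∃ ℓ : KSubset k, below ℓ.1 = a := by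
  set s : Finset ℤ := (Finset.Ico A B).filter fun d => a (d + 1) = a d + 1 with hs
  have hmem : ∀ d, d ∈ s ↔ a (d + 1) = a d + 1 := by
    intro d
    rw [hs, Finset.mem_filter, Finset.mem_Ico, and_iff_right_iff_imp]
    intro h
    by_contra hd
    rcases not_and_or.1 hd with hd | hd
    · rw [hA d (by omega), hA (d + 1) (by omega)] at h
      omega
    · rw [hB d (by omega), hB (d + 1) (by omega)] at h
      omega
  have hstep : ∀ d, below s (d + 1) + a d = below s d + a (d + 1) := by
    intro d
    rw [below_add_one]
    have := h1 d
    have := h2 d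
    have := hmem d
    by_cases hd : d ∈ s
    · rw [if_pos hd, this.1 hd]
      ring
    · have : a (d + 1) ≠ a d + 1 := fun h => hd ((hmem d).2 h)
      rw [if_neg hd]
      omega
  obtain ⟨e, heA, he0⟩ := exists_below_eq_zero s A
  have hconst : ∀ d, below s d = a d := by
    have hbase : below s e = a e := by rw [he0, hA e heA.le]
    have hup : ∀ d, e ≤ d → below s d = a d := by
      intro d hd
      induction d, hd using Int.leInduction with
      | base => exact hbase
      | succ d _ ih =>
        have := hstep d
        omega
    intro d
    rcases le_total e d with hd | hd
    · exact hup d hd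
    · have := below_mono s hd
      rw [hA d (by omega)]
      omega
  obtain ⟨f, hf, hfk⟩ := exists_below_eq_card s B
  refine ⟨⟨s, ?_⟩, funext hconst⟩
  rw [← hfk, hconst, hB f (by omega)]

section RankOne

variable {k : ℕ} {M : GrMod.{u} k}

/-- A homogeneous element which freely generates the localization of `M` at `y`. -/
structure IsGenericGenerator (M : GrMod.{u} k) (d : ℤ) (m : M.carrier) : Prop where
  mem : m ∈ M.deg d
  free : ∀ r : R k, r • m = 0 → r = 0
  gen : ∀ z : M.carrier, ∃ (n : ℕ) (r : R k), yR k ^ n • z = r • m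

theorem one_tmul_smul (r : R k) (m : M.carrier) :
    (1 : F k) ⊗ₜ[R k] (r • m) = algebraMap (R k) (F k) r • ((1 : F k) ⊗ₜ[R k] m) := by
  rw [← TensorProduct.smul_tmul, TensorProduct.smul_tmul', smul_eq_mul, mul_one]
  exact congrArg (· ⊗ₜ[R k] m) (Algebra.algebraMap_eq_smul_one r).symm

theorem exists_smul_eq_one_tmul {d : ℤ} {z : F k ⊗[R k] M.carrier} (hz : z ∈ M.genericDeg d) :
    ∃ n : ℕ, ∃ m ∈ M.deg (d - n),
      algebraMap (R k) (F k) (yR k ^ n) • z = (1 : F k) ⊗ₜ[R k] m := by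
  induction hz using AddSubgroup.closure_induction with
  | mem z hz =>
    obtain ⟨i, j, f, m, rfl, ⟨n, r, hr, hf⟩, hm, rfl⟩ := hz
    refine ⟨n, r • m, GrMod.mem_deg_of_eq (M.smul_mem hr hm) (by ring), ?_⟩
    rw [one_tmul_smul, TensorProduct.smul_tmul', TensorProduct.smul_tmul', smul_eq_mul,
      smul_eq_mul, mul_one, ← hf, map_pow, mul_comm]
  | zero => exact ⟨0, 0, zero_mem _, by simp⟩
  | add z w _ _ hz hw =>
    obtain ⟨n, m, hm, h1⟩ := hz
    obtain ⟨n', m', hm', h2⟩ := hw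
    refine ⟨n + n', yR k ^ n' • m + yR k ^ n • m', add_mem ?_ ?_, ?_⟩
    · exact GrMod.mem_deg_of_eq (GrMod.y_pow_smul_mem n' hm) (by push_cast; ring)
    · exact GrMod.mem_deg_of_eq (GrMod.y_pow_smul_mem n hm') (by push_cast; ring)
    · rw [TensorProduct.tmul_add, one_tmul_smul, one_tmul_smul, ← h1, ← h2, smul_smul, smul_smul,
        ← map_mul, ← map_mul, ← pow_add, ← pow_add, add_comm n' n, smul_add]
  | neg z _ hz =>
    obtain ⟨n, m, hm, h1⟩ := hz
    exact ⟨n, -m, neg_mem hm, by rw [smul_neg, h1, TensorProduct.tmul_neg]⟩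

theorem GrMod.IsGenericallyFree.exists_isGenericGenerator (hM : M.IsGenericallyFree 1)
    (hy : ∀ z : M.carrier, yR k • z = 0 → z = 0) : ∃ d m, IsGenericGenerator M d m := by
  obtain ⟨b, hb⟩ := hM
  obtain ⟨d, hd⟩ := hb 0
  obtain ⟨n, m, hm, hbm⟩ := exists_smul_eq_one_tmul hd
  refine ⟨_, m, hm, fun r hr => ?_, fun z => ?_⟩
  · have h1 : algebraMap (R k) (F k) (r * yR k ^ n) • b 0 = 0 := by
      rw [map_mul, mul_smul, hbm, ← one_tmul_smul, hr, TensorProduct.tmul_zero]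
    have h2 : algebraMap (R k) (F k) (r * yR k ^ n) = 0 := by
      have := congrArg (fun w => b.repr w 0) h1
      simpa using this
    obtain ⟨⟨c, hc⟩, h3⟩ := (IsLocalization.map_eq_zero_iff (Submonoid.powers (yR k)) (F k) _).1 h2
    obtain ⟨j, rfl⟩ := hc
    refine eq_zero_of_yR_pow_mul_eq_zero (j + n) ?_
    rw [← h3]
    change yR k ^ (j + n) * r = yR k ^ j * (r * yR k ^ n)
    ring
  · obtain ⟨c, hc⟩ : ∃ c : F k, (1 : F k) ⊗ₜ[R k] z = c • b 0 := by
      refine ⟨b.repr ((1 : F k) ⊗ₜ[R k] z) 0, ?_⟩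
      have := b.sum_repr ((1 : F k) ⊗ₜ[R k] z)
      rw [Fin.sum_univ_one] at this
      exact this.symm
    obtain ⟨⟨r, ⟨s, ⟨j, rfl⟩⟩⟩, hr⟩ := IsLocalization.surj (Submonoid.powers (yR k)) c
    have h1 : (1 : F k) ⊗ₜ[R k] (yR k ^ (n + j) • z - r • m) = 0 := by
      have hr' : c * algebraMap (R k) (F k) (yR k ^ j) = algebraMap (R k) (F k) r := hr
      rw [TensorProduct.tmul_sub, one_tmul_smul, one_tmul_smul, hc, ← hbm, smul_smul, smul_smul,
        ← sub_smul, ← hr', pow_add, map_mul, sub_eq_zero.2 (by ring), zero_smul]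
    have h3 : TensorProduct.mk (R k) (F k) M.carrier 1 (yR k ^ (n + j) • z - r • m) = 0 := h1
    rw [IsLocalizedModule.eq_zero_iff (Submonoid.powers (yR k))] at h3
    obtain ⟨⟨c, ⟨i, rfl⟩⟩, h4⟩ := h3
    exact ⟨n + j, r, sub_eq_zero.1 (GrMod.y_pow_regular hy i _ h4)⟩

namespace IsGenericGenerator

variable {d₀ : ℤ} {m : M.carrier} (hm : IsGenericGenerator M d₀ m)

include hm

theorem coeffR_eq {z : M.carrier} {n n' : ℕ} {r r' : R k} (h : yR k ^ n • z = r • m)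
    (h' : yR k ^ n' • z = r' • m) : coeffR k r = coeffR k r' := by
  have h1 : yR k ^ n' * r - yR k ^ n * r' = 0 := by
    refine hm.free _ ?_
    rw [sub_smul, mul_smul, mul_smul, ← h, ← h', smul_comm, sub_self]
  rw [← coeffR_y_pow_mul n' r, sub_eq_zero.1 h1, coeffR_y_pow_mul]

/-- If `z` is homogeneous and `y ^ n z = r m`, then `r` is homogeneous. -/
theorem mem_piece {d : ℤ} {z : M.carrier} (hz : z ∈ M.deg d) {n : ℕ} {r : R k}
    (h : yR k ^ n • z = r • m) : r ∈ piece k (d - n - d₀) := by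
  have key : ∀ (r : R k) (e : ℤ),
      M.comp (e + d₀) (r • m) = (DirectSum.decompose (piece k) r e : R k) • m := by
    intro r e
    induction r using DirectSum.Decomposition.inductionOn (piece k) with
    | zero => rw [zero_smul_eq, map_zero, DirectSum.decompose_zero, DirectSum.zero_apply,
        ZeroMemClass.coe_zero, zero_smul_eq]
    | @homogeneous i r =>
      by_cases hi : i = e
      · subst hi
        rw [DirectSum.decompose_coe, DirectSum.of_eq_same,
          GrMod.comp_of_mem (M.smul_mem r.2 hm.mem)]
      · rw [DirectSum.decompose_of_mem_ne (piece k) r.2 hi, zero_smul_eq,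
          GrMod.comp_of_mem_ne (M.smul_mem r.2 hm.mem) (by omega)]
    | add r s hr hs =>
      rw [add_smul, map_add, hr, hs, DirectSum.decompose_add, DirectSum.add_apply,
        Submodule.coe_add, add_smul]
  have h1 : r - (DirectSum.decompose (piece k) r (d - n - d₀) : R k) = 0 := by
    refine hm.free _ ?_
    rw [sub_smul, ← key, sub_add_cancel, ← h, GrMod.comp_of_mem (GrMod.y_pow_smul_mem n hz),
      sub_self]
  rw [sub_eq_zero.1 h1]
  exact SetLike.coe_mem _

/-- The coefficients of `z` are those of `r`, where `y ^ n z = r m`. -/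
def coeff : M.carrier →+ (ℕ → ℂ) :=
  AddMonoidHom.mk' (fun z => coeffR k (hm.gen z).choose_spec.choose) fun z w => by
    rw [← coeffR_y_pow_mul (hm.gen w).choose (hm.gen z).choose_spec.choose,
      ← coeffR_y_pow_mul (hm.gen z).choose (hm.gen w).choose_spec.choose, ← map_add]
    refine hm.coeffR_eq (hm.gen (z + w)).choose_spec.choose_spec
      (n' := (hm.gen z).choose + (hm.gen w).choose) ?_
    rw [add_smul, mul_smul, mul_smul, ← (hm.gen z).choose_spec.choose_spec,
      ← (hm.gen w).choose_spec.choose_spec, smul_add, pow_add, mul_smul, mul_smul,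
      smul_comm (yR k ^ (hm.gen z).choose) _ z]

theorem coeff_eq {z : M.carrier} {n : ℕ} {r : R k} (h : yR k ^ n • z = r • m) :
    hm.coeff z = coeffR k r :=
  hm.coeffR_eq (hm.gen z).choose_spec.choose_spec h

theorem coeff_scalar (c : ℂ) (z : M.carrier) :
    hm.coeff (algebraMap ℂ (R k) c • z) = c • hm.coeff z := by
  obtain ⟨n, r, h⟩ := hm.gen z
  rw [hm.coeff_eq h, ← map_smul, hm.coeff_eq (n := n) (r := algebraMap ℂ (R k) c * r)
    (by rw [smul_comm, h, mul_smul]), ← Algebra.smul_def]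

theorem coeff_x (z : M.carrier) : hm.coeff (xR k • z) = shift k (hm.coeff z) := by
  obtain ⟨n, r, h⟩ := hm.gen z
  rw [hm.coeff_eq h, ← coeffR_x_mul]
  exact hm.coeff_eq (n := n) (by rw [smul_comm, h, mul_smul])

theorem coeff_y (z : M.carrier) : hm.coeff (yR k • z) = hm.coeff z := by
  obtain ⟨n, r, h⟩ := hm.gen z
  rw [hm.coeff_eq h, ← coeffR_y_mul]
  exact hm.coeff_eq (n := n) (by rw [smul_comm, h, mul_smul])

theorem eq_zero_of_coeff_eq_zero (hy : ∀ z : M.carrier, yR k • z = 0 → z = 0) {d : ℤ}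
    {z : M.carrier} (hz : z ∈ M.deg d) (h0 : hm.coeff z = 0) : z = 0 := by
  obtain ⟨n, r, h⟩ := hm.gen z
  rw [hm.coeff_eq h] at h0
  rw [eq_zero_of_coeffR_eq_zero (hm.mem_piece hz h) h0, zero_smul_eq] at h
  exact GrMod.y_pow_regular hy n z h

theorem exists_uniform : ∃ n : ℕ, ∀ z : M.carrier, ∃ r : R k, yR k ^ n • z = r • m := by
  classical
  obtain ⟨S, hS⟩ := M.finite.fg_top
  choose n r h using hm.gen
  refine ⟨S.sup n, fun z => ?_⟩
  have hz : z ∈ Submodule.span (R k) (S : Set M.carrier) := by rw [hS]; exact Submodule.mem_top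
  induction hz using Submodule.span_induction with
  | mem z hz =>
    refine ⟨yR k ^ (S.sup n - n z) * r z, ?_⟩
    rw [mul_smul, ← h, ← mul_smul, ← pow_add, Nat.sub_add_cancel (Finset.le_sup hz)]
  | zero => exact ⟨0, by rw [smul_zero, zero_smul_eq]⟩
  | add z w _ _ hz hw =>
    obtain ⟨a, ha⟩ := hz
    obtain ⟨b, hb⟩ := hw
    exact ⟨a + b, by rw [smul_add, ha, hb, add_smul]⟩
  | smul c z _ hz =>
    obtain ⟨a, ha⟩ := hz
    exact ⟨c * a, by rw [smul_comm, ha, mul_smul]⟩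

theorem exists_forall_eq_zero (hy : ∀ z : M.carrier, yR k • z = 0 → z = 0) :
    ∃ B : ℤ, ∀ d ≥ B, ∀ z ∈ M.deg d, z = 0 := by
  obtain ⟨n, hn⟩ := hm.exists_uniform
  refine ⟨n + d₀ + k, fun d hd z hz => ?_⟩
  obtain ⟨r, h⟩ := hn z
  rw [piece_eq_zero_of_le (by omega) (hm.mem_piece hz h), zero_smul_eq] at h
  exact GrMod.y_pow_regular hy n z h

theorem exists_chart_aux (hy : ∀ z : M.carrier, yR k • z = 0 → z = 0) :
    ∃ (a : ℤ → ℕ) (κ : Chart M a), κ.coeff = hm.coeff ∧ ∀ d, a d ≤ k := by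
  let W (d : ℤ) : Submodule ℂ (ℕ → ℂ) :=
    { carrier := {v | ∃ z ∈ M.deg d, hm.coeff z = v}
      zero_mem' := ⟨0, zero_mem _, map_zero _⟩
      add_mem' := by
        rintro _ _ ⟨z, hz, rfl⟩ ⟨w, hw, rfl⟩
        exact ⟨z + w, add_mem hz hw, map_add _ _ _⟩
      smul_mem' := by
        rintro c _ ⟨z, hz, rfl⟩
        exact ⟨_, GrMod.algebraMap_smul_mem c hz, hm.coeff_scalar c z⟩ }
  have hW : ∀ d, ∀ v ∈ W d, shift k v ∈ W d := by
    rintro d _ ⟨z, hz, rfl⟩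
    refine ⟨yR k • xR k • z, GrMod.mem_deg_of_eq (GrMod.y_smul_mem (GrMod.x_smul_mem hz))
      (by ring), ?_⟩
    rw [hm.coeff_y, hm.coeff_x]
  have hk : ∀ d, ∀ v ∈ W d, ∀ j, k ≤ j → v j = 0 := by
    rintro d _ ⟨z, hz, rfl⟩ j hj
    obtain ⟨n, r, h⟩ := hm.gen z
    rw [hm.coeff_eq h]
    exact coeffR_eq_zero_of_le r hj
  choose a ha h using fun d => exists_eq_of_shift_mem (hW d) (hk d)
  exact ⟨a, ⟨hm.coeff, hm.coeff_scalar, hm.coeff_x, hm.coeff_y,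
    fun hz => hm.eq_zero_of_coeff_eq_zero hy hz, fun {d z} hz => (h d _).1 ⟨z, hz, rfl⟩,
    fun d v => (h d v).2⟩, rfl, ha⟩

end IsGenericGenerator

/-- Every generically free module of rank one on which `y` is injective has a chart given by a
`k`-subset of `ℤ`. -/
theorem exists_chart (hk : 0 < k) (hM : M.IsGenericallyFree 1)
    (hy : ∀ z : M.carrier, yR k • z = 0 → z = 0) :
    ∃ ℓ : KSubset k, Nonempty (Chart M (below ℓ.1)) := by
  obtain ⟨d₀, m, hm⟩ := hM.exists_isGenericGenerator hy
  obtain ⟨a, κ, hκ, ha⟩ := hm.exists_chart_aux hy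
  obtain ⟨B, hB⟩ := hm.exists_forall_eq_zero hy
  have hsingle : ∀ d, a d < k → ∃ z ∈ M.deg d, κ.coeff z = Pi.single (a d) 1 := fun d hd =>
    κ.exists_coeff_eq d _ fun j hj => Pi.single_eq_of_ne (by omega) _
  have hmono : ∀ d, a d ≤ a (d + 1) := by
    intro d
    by_contra h
    have := ha d
    obtain ⟨z, hz, h1⟩ := hsingle (d + 1) (by omega)
    have h2 := κ.coeff_apply_eq_zero (GrMod.y_smul_mem hz) (a (d + 1))
      (Or.inl (by rw [add_sub_cancel_right]; omega))
    rw [κ.coeff_y, h1, Pi.single_eq_same] at h2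
    exact one_ne_zero h2
  have hstep : ∀ d, a (d + 1) ≤ a d + 1 := by
    intro d
    by_contra h
    have := ha (d + 1)
    obtain ⟨z, hz, h1⟩ := hsingle d (by omega)
    have h2 := κ.coeff_apply_eq_zero (GrMod.x_smul_mem hz) (a d + 1) (Or.inl (by omega))
    rw [κ.coeff_x, shift_succ _ (by omega), h1, Pi.single_eq_same] at h2
    exact one_ne_zero h2
  have hleft : ∀ d ≤ d₀, a d = 0 := by
    intro d hd
    by_contra h
    have h1 := κ.coeff_apply_eq_zero (GrMod.y_pow_smul_mem (d₀ - d).toNat hm.mem) 0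
      (Or.inl (by rw [show d₀ - ((d₀ - d).toNat : ℕ) = d by omega]; omega))
    have h3 : hm.coeff m = Pi.single 0 1 := by
      rw [hm.coeff_eq (n := 0) (r := 1) (by rw [pow_zero])]
      simpa using coeffR_monomial hk 0
    rw [κ.coeff_y_pow, hκ, h3, Pi.single_eq_same] at h1
    exact one_ne_zero h1
  have hright : ∀ d ≥ B, a d = k := by
    intro d hd
    by_contra h
    obtain ⟨z, hz, h1⟩ := hsingle d (lt_of_le_of_ne (ha d) h)
    rw [hB d hd z hz, map_zero] at h1
    have := congrFun h1 (a d)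
    rw [Pi.single_eq_same] at this
    exact zero_ne_one this
  obtain ⟨ℓ, hℓ⟩ := exists_below_eq a hmono hstep hleft hright
  exact ⟨ℓ, ⟨hℓ ▸ κ⟩⟩

end RankOne

/-! ### The chart of the module `I(ℓ)` -/

namespace KSubset

variable {k : ℕ}

theorem entry_eq_nth (ℓ : KSubset k) (p : Fin k) : ℓ.entry p = ℓ.nth p := by
  rw [nth, dif_pos p.2]

theorem top_eq_nth (hk : 2 ≤ k) (ℓ : KSubset k) : ℓ.top hk = ℓ.nth (k - 1) := by
  rw [top, entry_eq_nth]

theorem nth_le (hk : 2 ≤ k) (ℓ : KSubset k) {p : ℕ} (hp : p < k) :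
    ℓ.nth p ≤ ℓ.top hk - (k - (p + 1)) := by
  have h1 : ℓ.nth p ≤ ℓ.nth (k - 1) := by
    rw [le_nth_iff (by omega), below_nth hp]
    omega
  have h2 := below_le_add_sub ℓ.1 h1
  rw [below_nth hp, below_nth (by omega)] at h2
  rw [top_eq_nth]
  omega

theorem yExponent_eq (hk : 2 ≤ k) (ℓ : KSubset k) (p : Fin k) :
    (ℓ.yExponent hk p : ℤ) = ℓ.top hk - ℓ.nth p - (k - (p + 1)) := by
  have := nth_le hk ℓ p.2
  rw [yExponent, entry_eq_nth]
  omega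

/-- The homogeneous components of an element of the ideal satisfy the vanishing conditions that
define the chart. -/
theorem coeffR_decompose_eq_zero (hk : 2 ≤ k) (ℓ : KSubset k) {f : R k} (hf : f ∈ ℓ.ideal hk) :
    ∀ (d : ℤ), ∀ j < below ℓ.1 (d - (k - 1 - ℓ.top hk)),
      coeffR k (DirectSum.decompose (piece k) f d) j = 0 := by
  let S : AddSubgroup (R k) :=
    { carrier := {f | ∀ (d : ℤ), ∀ j < below ℓ.1 (d - (k - 1 - ℓ.top hk)),
        coeffR k (DirectSum.decompose (piece k) f d) j = 0}
      zero_mem' := fun d j _ => by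
        rw [DirectSum.decompose_zero, DirectSum.zero_apply, ZeroMemClass.coe_zero, map_zero,
          Pi.zero_apply]
      add_mem' := fun {f g} hf hg d j hj => by
        rw [DirectSum.decompose_add, DirectSum.add_apply, Submodule.coe_add, map_add, Pi.add_apply,
          hf d j hj, hg d j hj, add_zero]
      neg_mem' := fun {f} hf d j hj => by
        rw [DirectSum.decompose_neg, DFinsupp.neg_apply, Submodule.coe_neg, map_neg, Pi.neg_apply,
          hf d j hj, neg_zero] }
  have hdec : ∀ {i : ℤ} {r : R k}, r ∈ piece k i → ∀ (f : R k) (d : ℤ),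
      (DirectSum.decompose (piece k) (r * f) d : R k) =
        r * DirectSum.decompose (piece k) f (d - i) := by
    intro i r hr f d
    rw [← DirectSum.coe_decompose_mul_add_of_left_mem (piece k) hr, add_sub_cancel]
  have hS : ∀ r : R k, ∀ f ∈ S, r • f ∈ S := by
    refine smul_mem_of_generators S (fun c f hf d j hj => ?_) (fun f hf d j hj => ?_)
      (fun f hf d j hj => ?_)
    · rw [smul_eq_mul, hdec (algebraMap_mem_piece c), ← Algebra.smul_def, map_smul, Pi.smul_apply,
        sub_zero, hf d j hj, smul_zero]
    · rw [smul_eq_mul, hdec (xR_mem k), coeffR_x_mul]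
      rcases j with _ | j
      · exact shift_zero _ _
      · rw [shift_succ _ (hj.trans_le (below_le _))]
        refine hf (d - 1) j ?_
        have := below_le_add_one ℓ.1 (d - 1 - (k - 1 - ℓ.top hk))
        rw [show d - 1 - (k - 1 - ℓ.top hk) + 1 = d - (k - 1 - ℓ.top hk) by ring] at this
        omega
    · rw [smul_eq_mul, hdec (yR_mem k), coeffR_y_mul]
      exact hf _ j (hj.trans_le (below_mono ℓ.1 (by omega)))
  have hle : ∀ f ∈ ℓ.ideal hk, f ∈ S := by
    intro f hf
    induction hf using Submodule.span_induction with
    | mem f hf =>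
      obtain ⟨p, rfl⟩ := hf
      intro d j hj
      have hmem := monomial_mem_piece (k := k) p (ℓ.yExponent hk p)
      by_cases h : (p : ℤ) - (ℓ.yExponent hk p : ℕ) = d
      · rw [DirectSum.decompose_of_mem_same (piece k) (h ▸ hmem), coeffR_monomial p.2]
        have h1 := yExponent_eq hk ℓ p
        rw [show d - (k - 1 - ℓ.top hk) = ℓ.nth p by omega, below_nth p.2] at hj
        exact Pi.single_eq_of_ne (by omega) _
      · rw [DirectSum.decompose_of_mem_ne (piece k) hmem h, map_zero, Pi.zero_apply]
    | zero => exact S.zero_mem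
    | add f g _ _ hf hg => exact S.add_mem hf hg
    | smul r f _ hf => exact hS r f hf
  exact hle f hf

/-- The chart of `I(ℓ)`. -/
def chart (hk : 2 ≤ k) (ℓ : KSubset k) : Chart (ℓ.toModule hk) (below ℓ.1) where
  coeff := (coeffR k).toAddMonoidHom.comp (ℓ.ideal hk).subtype.toAddMonoidHom
  coeff_scalar c z := by
    change coeffR k (algebraMap ℂ (R k) c * ((show ℓ.ideal hk from z) : R k)) = _
    rw [← Algebra.smul_def, map_smul]
    rfl
  coeff_x z := coeffR_x_mul _
  coeff_y z := coeffR_y_mul _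
  eq_zero {d z} hz h := Subtype.ext (eq_zero_of_coeffR_eq_zero hz h)
  coeff_apply_eq_zero {d z} hz j hj := by
    change coeffR k ((show ℓ.ideal hk from z) : R k) j = 0
    have hz' : ((show ℓ.ideal hk from z) : R k) ∈ piece k (d + (k - 1 - ℓ.top hk)) := hz
    rcases hj with hj | hj
    · rw [← DirectSum.decompose_of_mem_same (piece k) hz']
      refine coeffR_decompose_eq_zero hk ℓ (show ℓ.ideal hk from z).2 _ j ?_
      rwa [add_sub_cancel_right]
    · exact coeffR_eq_zero_of_le _ hj
  exists_coeff_eq d v hv := by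
    obtain ⟨h1, h2⟩ := exists_piece_coeffR_eq (k := k) (d + (k - 1 - ℓ.top hk)) v fun j hj => by
      by_cases hjk : j < k
      · refine hv j (Or.inl ((nth_lt_iff hjk).1 ?_))
        have := nth_le hk ℓ hjk
        omega
      · exact hv j (Or.inr (not_lt.1 hjk))
    suffices h : (∑ j ∈ Finset.range k, v j • (xR k ^ j * yR k ^
        (j - (d + (k - 1 - ℓ.top hk))).toNat)) ∈ ℓ.ideal hk from
      ⟨(⟨_, h⟩ : ℓ.ideal hk), h1, h2⟩
    refine sum_mem fun j hj => ?_
    have hjk := Finset.mem_range.1 hj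
    by_cases h : j < below ℓ.1 d
    · rw [hv j (Or.inl h), zero_smul]
      exact zero_mem _
    · rw [not_lt, ← le_nth_iff hjk] at h
      have h3 := yExponent_eq hk ℓ ⟨j, hjk⟩
      rw [← Nat.sub_add_cancel (show ℓ.yExponent hk ⟨j, hjk⟩ ≤
        ((j : ℤ) - (d + (k - 1 - ℓ.top hk))).toNat by dsimp only at h3; omega), pow_add,
        mul_left_comm]
      have h4 : algebraMap ℂ (R k) (v j) * _ ∈ ℓ.ideal hk := Ideal.mul_mem_left _ _
        (Ideal.mul_mem_left _ (yR k ^ (((j : ℤ) - (d + (k - 1 - ℓ.top hk))).toNat -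
          ℓ.yExponent hk ⟨j, hjk⟩)) (Ideal.subset_span ⟨⟨j, hjk⟩, rfl⟩))
      rw [← Algebra.smul_def] at h4
      exact h4

end KSubset

theorem corresponds_iff {k : ℕ} (hk : 2 ≤ k) {M : GrMod.{u} k} {ℓ : KSubset k} :
    Corresponds hk M ℓ ↔ Nonempty (Chart M (below ℓ.1)) :=
  ⟨fun ⟨e⟩ => ⟨(ℓ.chart hk).ofIso e⟩, fun ⟨κ⟩ => ⟨κ.iso (ℓ.chart hk)⟩⟩

theorem existsUnique_corresponds {k : ℕ} (hk : 2 ≤ k) {M : GrMod.{u} k} (hM : M.IsMCM)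
    (hM₁ : M.IsGenericallyFree 1) : ∃! ℓ : KSubset k, Corresponds hk M ℓ := by
  obtain ⟨ℓ, ⟨κ⟩⟩ := exists_chart (by omega) hM₁ (hM.y_regular (by omega))
  refine ⟨ℓ, (corresponds_iff hk).2 ⟨κ⟩, fun ℓ' h => ?_⟩
  obtain ⟨κ'⟩ := (corresponds_iff hk).1 h
  exact κ'.unique κ

/-! ### Splitting extensions -/

section Ext

variable {k : ℕ}

theorem Chart.coeff_eq_zero_of_le {M : GrMod.{u} k} {a : ℤ → ℕ} (κ : Chart M a) (z : M.carrier)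
    {j : ℕ} (hj : k ≤ j) : κ.coeff z j = 0 := by
  induction z using GrMod.homogeneous_induction with
  | homogeneous d z hz => exact κ.coeff_apply_eq_zero hz j (Or.inr hj)
  | add z w hz hw => rw [map_add, Pi.add_apply, hz, hw, add_zero]

variable {I J : GrMod.{u} k} {ℓ m : KSubset k}

/-- An extension of `I(ℓ)` by `I(m)` splits if `ℓ` and `m` do not cross: the failure of arbitrary
lifts of the `e_p` to satisfy the relations between the `e_p` is measured by a shift system, and the
lifts can be corrected if that system is trivial. -/
theorem Extension.splits_of_not_cross (κI : Chart I (below ℓ.1)) (κJ : Chart J (below m.1))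
    (h : ¬ Cross ℓ.1 m.1) (X : Extension I J) : X.Splits := by
  have hker : ∀ z, X.proj.toLin z = 0 → ∃ w, X.inc.toLin w = z := fun z => (X.exact z).1
  have hlift : ∀ p : ℕ, ∃ z : X.mid.carrier,
      (p < k → z ∈ X.mid.deg (ℓ.nth p)) ∧ (k ≤ p → z = 0) ∧ X.proj.toLin z = κI.basis p := by
    intro p
    by_cases hp : p < k
    · obtain ⟨z, hz, hzp⟩ := X.proj.exists_mem_deg_of_surjective X.surjective (κI.basis_mem hp)
      exact ⟨z, fun _ => hz, fun h => absurd hp (not_lt.2 h), hzp⟩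
    · exact ⟨0, fun h => absurd h hp, fun _ => rfl, by rw [map_zero, κI.basis_of_le (not_lt.1 hp)]⟩
  choose ε hεmem hε0 hεproj using hlift
  have hδ : ∀ p : ℕ, ∃ w : J.carrier, p < k →
      X.inc.toLin w = xR k • ε p - yR k ^ ℓ.gap p • ε (p + 1) := by
    intro p
    by_cases hp : p < k
    · obtain ⟨w, hw⟩ := hker (xR k • ε p - yR k ^ ℓ.gap p • ε (p + 1)) (by
        rw [map_sub, map_smul, map_smul, hεproj, hεproj, κI.x_smul_basis hp, sub_self])
      exact ⟨w, fun _ => hw⟩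
    · exact ⟨0, fun h => absurd h hp⟩
  choose δ hδ using hδ
  have hδmem : ∀ p < k, δ p ∈ J.deg (ℓ.nth p + 1) := by
    intro p hp
    refine X.inc.mem_deg_of_injective X.injective ?_
    rw [hδ p hp]
    exact sub_mem (GrMod.x_smul_mem (hεmem p hp))
      (KSubset.y_pow_gap_smul_mem (hεmem (p + 1)) (hε0 (p + 1)))
  -- the elements `x ^ p ε_0 - y ^ _ ε_p` come from `J`, and their coefficients form, up to the
  -- sign, the shift system
  set A : ℕ → ℕ := fun p => ∑ q ∈ Finset.range p, ℓ.gap q with hA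
  have hρ : ∀ p : ℕ, ∃ w : J.carrier, p ≤ k →
      X.inc.toLin w = xR k ^ p • ε 0 - yR k ^ A p • ε p := by
    intro p
    by_cases hp : p ≤ k
    · have h1 : ∀ p ≤ k, xR k ^ p • κI.basis 0 = yR k ^ A p • κI.basis p := by
        intro p
        induction p with
        | zero => exact fun _ => rfl
        | succ p ih =>
          intro hp
          rw [pow_succ', mul_smul, ih (by omega), smul_comm, κI.x_smul_basis hp, ← mul_smul,
            ← pow_add, hA]
          dsimp only
          rw [Finset.sum_range_succ]
      obtain ⟨w, hw⟩ := hker (xR k ^ p • ε 0 - yR k ^ A p • ε p) (by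
        rw [map_sub, map_smul, map_smul, hεproj, hεproj, h1 p hp, sub_self])
      exact ⟨w, fun _ => hw⟩
    · exact ⟨0, fun h => absurd h hp⟩
  choose ρ hρ using hρ
  have hrel : ∀ p < k, xR k • ρ p = ρ (p + 1) - yR k ^ A p • δ p := by
    intro p hp
    apply X.injective
    rw [map_smul, map_sub, map_smul, hρ p hp.le, hρ (p + 1) hp, hδ p hp, smul_sub, smul_sub,
      ← mul_smul, ← pow_succ', ← mul_smul (yR k ^ A p) (yR k ^ ℓ.gap p), ← pow_add,
      show A p + ℓ.gap p = A (p + 1) from (Finset.sum_range_succ _ _).symm,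
      smul_comm (xR k) (yR k ^ A p)]
    abel
  have hcoeff : ∀ p < k, κJ.coeff (δ p) = κJ.coeff (ρ (p + 1)) - shift k (κJ.coeff (ρ p)) := by
    intro p hp
    rw [← κJ.coeff_x, hrel p hp, map_sub, κJ.coeff_y_pow]
    abel
  have hρk : ρ k = 0 := by
    apply X.injective
    rw [hρ k le_rfl, xR_pow_eq_zero, zero_smul_eq, hε0 k le_rfl, smul_zero, sub_zero, map_zero]
  have hsys : KSubset.IsShiftSystem ℓ m fun p => - κJ.coeff (ρ p) := by
    refine ⟨by rw [hρk, map_zero, neg_zero], fun p hp j hj => ?_⟩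
    have h1 := congrFun (hcoeff p hp) j
    rw [κJ.coeff_apply_eq_zero (hδmem p hp) j (Or.inl hj), Pi.sub_apply] at h1
    rw [map_neg, Pi.neg_apply, Pi.neg_apply, sub_eq_zero.1 h1.symm]
  obtain ⟨c, hc⟩ := hsys.isTrivialSystem h
  have hη : ∀ p : ℕ, ∃ w : J.carrier, (p < k → w ∈ J.deg (ℓ.nth p)) ∧ (k ≤ p → w = 0) ∧
      (p ≤ k → ∀ j, κJ.coeff w j =
        - κJ.coeff (ρ p) j - if p ≤ j ∧ j < k then c (j - p) else 0) := by
    intro p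
    by_cases hp : p < k
    · obtain ⟨w, hw, hw'⟩ := κJ.exists_coeff_eq (ℓ.nth p)
        (fun j => - κJ.coeff (ρ p) j - if p ≤ j ∧ j < k then c (j - p) else 0) (by
          intro j hj
          by_cases hjk : j < k
          · have h1 := hc p hp j (hj.resolve_right (not_le.2 hjk))
            dsimp only at h1
            rw [Pi.neg_apply] at h1
            rw [h1]
            simp [hjk]
          · rw [κJ.coeff_eq_zero_of_le _ (not_lt.1 hjk), if_neg (by omega)]
            simp)
      exact ⟨w, fun _ => hw, fun h => absurd hp (not_lt.2 h), fun _ j => congrFun hw' j⟩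
    · refine ⟨0, fun h => absurd h hp, fun _ => rfl, fun hpk j => ?_⟩
      rw [show p = k by omega, hρk, map_zero, if_neg (by omega)]
      simp
  choose η hηmem hη0 hηc using hη
  have hzero : ∀ p < k, δ p - xR k • η p + yR k ^ ℓ.gap p • η (p + 1) = 0 := by
    intro p hp
    refine κJ.eq_zero (add_mem (sub_mem (hδmem p hp) (GrMod.x_smul_mem (hηmem p hp)))
      (KSubset.y_pow_gap_smul_mem (hηmem (p + 1)) (hη0 (p + 1)))) ?_
    ext j
    rw [map_add, map_sub, hcoeff p hp, κJ.coeff_x, κJ.coeff_y_pow, Pi.add_apply, Pi.sub_apply,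
      Pi.sub_apply, hηc (p + 1) hp, Pi.zero_apply]
    rcases j with _ | j
    · rw [shift_zero, shift_zero, if_neg (by omega)]
      ring
    · by_cases hj : j + 1 < k
      · rw [shift_succ _ hj, shift_succ _ hj, hηc p hp.le, Nat.add_sub_add_right]
        by_cases hpj : p ≤ j
        · rw [if_pos (by omega), if_pos (by omega)]
          ring
        · rw [if_neg (by omega), if_neg (by omega)]
          ring
      · rw [shift_apply, shift_apply, if_neg (by omega), if_neg (by omega), if_neg (by omega)]
        ring
  have hrelε : ∀ p < k, xR k • (ε p - X.inc.toLin (η p)) =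
      yR k ^ ℓ.gap p • (ε (p + 1) - X.inc.toLin (η (p + 1))) := by
    intro p hp
    have h1 := congrArg X.inc.toLin (hzero p hp)
    rw [map_add, map_sub, hδ p hp, map_smul, map_smul, map_zero] at h1
    rw [← sub_eq_zero, ← h1, smul_sub, smul_sub]
    abel
  have hmem : ∀ p < k, ε p - X.inc.toLin (η p) ∈ X.mid.deg (ℓ.nth p) := fun p hp =>
    sub_mem (hεmem p hp) (X.inc.map_deg (hηmem p hp))
  have hlast : ε k - X.inc.toLin (η k) = 0 := by
    rw [hε0 k le_rfl, hη0 k le_rfl, map_zero, sub_zero]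
  refine ⟨κI.lift _ hmem hrelε hlast, LinearMap.ext fun z => ?_⟩
  rw [LinearMap.comp_apply, LinearMap.id_apply]
  induction z using GrMod.homogeneous_induction with
  | homogeneous d z hz =>
    refine κI.ext_of_mem (X.proj.map_deg ((κI.lift _ hmem hrelε hlast).map_deg hz)) hz ?_
    have hproj : ∀ p, X.proj.toLin (ε p - X.inc.toLin (η p)) = κI.basis p := fun p => by
      rw [map_sub, hεproj, X.exact.apply_apply_eq_zero, sub_zero]
    rw [κI.lift_apply hmem hrelε hlast hz, map_sum]
    simp only [map_smul, hproj]
    exact κI.coeff_sum_basis (fun j hj => κI.coeff_eq_zero_of_le z hj) _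
  | add z w hz hw => rw [map_add, map_add, hz, hw]

/-! ### Constructing extensions -/

/-- A submodule of `A × B` that contains the homogeneous components of its elements, as a graded
module. -/
def GrMod.subProd (A B : GrMod.{u} k) (S : Submodule (R k) (A.carrier × B.carrier))
    (hS : ∀ z ∈ S, ∀ d, (A.comp d z.1, B.comp d z.2) ∈ S) : GrMod.{u} k where
  carrier := S
  deg d := ((A.deg d).prod (B.deg d)).comap S.subtype.toAddMonoidHom
  isInternal := by
    classical
    refine (isInternal_iff _).2 ⟨fun s f hf h0 i hi => ?_, fun z => ?_⟩
    · have hf1 : ∀ j, (f j : A.carrier × B.carrier).1 ∈ A.deg j := fun j => (hf j).1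
      have hf2 : ∀ j, (f j : A.carrier × B.carrier).2 ∈ B.deg j := fun j => (hf j).2
      have h1 : ∑ j ∈ s, (f j : A.carrier × B.carrier) = 0 := by
        simpa using congrArg (fun a : S => (a : A.carrier × B.carrier)) h0
      have h2 := congrArg (fun z => A.comp i z.1) h1
      have h3 := congrArg (fun z => B.comp i z.2) h1
      simp only [Prod.fst_sum, Prod.snd_sum, map_sum, Prod.fst_zero, Prod.snd_zero,
        map_zero] at h2 h3
      rw [Finset.sum_eq_single_of_mem i hi
        fun j _ hj => comp_of_mem_ne (hf1 j) hj, comp_of_mem (hf1 i)] at h2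
      rw [Finset.sum_eq_single_of_mem i hi
        fun j _ hj => comp_of_mem_ne (hf2 j) hj, comp_of_mem (hf2 i)] at h3
      exact Subtype.ext (Prod.ext h2 h3)
    · obtain ⟨s, hs, hsum⟩ := exists_eq_sum_comp (M := A) (z : A.carrier × B.carrier).1
      obtain ⟨t, ht, htum⟩ := exists_eq_sum_comp (M := B) (z : A.carrier × B.carrier).2
      refine ⟨s ∪ t, fun d => ⟨_, hS z z.2 d⟩, fun d => ⟨comp_mem d _, comp_mem d _⟩, ?_⟩
      refine Subtype.ext ?_
      rw [AddSubmonoidClass.coe_finsetSum]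
      refine Prod.ext ?_ ?_
      · rw [Prod.fst_sum]
        refine (Finset.sum_subset Finset.subset_union_left fun d _ hd => ?_).symm.trans ?_
        · exact hs d hd
        · exact hsum.symm
      · rw [Prod.snd_sum]
        refine (Finset.sum_subset Finset.subset_union_right fun d _ hd => ?_).symm.trans ?_
        · exact ht d hd
        · exact htum.symm
  smul_mem {i j r z} hr hz := ⟨A.smul_mem hr hz.1, B.smul_mem hr hz.2⟩
  finite := inferInstance

/-- The linear combination of the terms of the family `r` with coefficients `v`. -/
def mix (k : ℕ) (r : ℕ → ℕ → ℂ) : (ℕ → ℂ) →ₗ[ℂ] (ℕ → ℂ) where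
  toFun v := ∑ p ∈ Finset.range k, v p • r p
  map_add' v w := by
    rw [← Finset.sum_add_distrib]
    exact Finset.sum_congr rfl fun p _ => add_smul _ _ _
  map_smul' c v := by
    rw [RingHom.id_apply, Finset.smul_sum]
    exact Finset.sum_congr rfl fun p _ => mul_smul _ _ _

theorem mix_apply (r : ℕ → ℕ → ℂ) (v : ℕ → ℂ) (j : ℕ) :
    mix k r v j = ∑ p ∈ Finset.range k, v p * r p j := by
  change (∑ p ∈ Finset.range k, v p • r p) j = _
  rw [Finset.sum_apply]
  rfl

theorem mix_single (r : ℕ → ℕ → ℂ) {p : ℕ} (hp : p < k) : mix k r (Pi.single p 1) = r p := by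
  ext j
  rw [mix_apply, Finset.sum_eq_single_of_mem p (Finset.mem_range.2 hp)
    fun q _ hq => by rw [Pi.single_eq_of_ne hq, zero_mul], Pi.single_eq_same, one_mul]

theorem KSubset.IsShiftSystem.mix_shift {r : ℕ → ℕ → ℂ} (hr : KSubset.IsShiftSystem ℓ m r)
    (κI : Chart I (below ℓ.1)) {d : ℤ} {b : I.carrier} (hb : b ∈ I.deg d) {j : ℕ}
    (hj : j < below m.1 (d + 1)) :
    mix k r (shift k (κI.coeff b)) j = shift k (mix k r (κI.coeff b)) j := by
  set v := κI.coeff b with hv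
  have h1 : shift k (mix k r v) j = ∑ p ∈ Finset.range k, v p * r (p + 1) j := by
    change shift k (∑ p ∈ Finset.range k, v p • r p) j = _
    rw [map_sum, Finset.sum_apply]
    refine Finset.sum_congr rfl fun p hp => ?_
    have hp := Finset.mem_range.1 hp
    rw [map_smul, Pi.smul_apply, smul_eq_mul]
    rcases κI.coeff_eq_zero_or_le hb hp with h | h
    · rw [hv, h, zero_mul, zero_mul]
    · rw [hr.link p hp j (hj.trans_le (below_mono m.1 (by omega)))]
  set g : ℕ → ℂ := fun p => (if 0 < p then v (p - 1) else 0) * r p j with hg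
  have h2 : mix k r (shift k v) j = ∑ p ∈ Finset.range k, g p := by
    rw [mix_apply]
    refine Finset.sum_congr rfl fun p hp => ?_
    rw [shift_apply, hg]
    simp only [Finset.mem_range.1 hp, and_true]
  have h3 := Finset.sum_range_succ g k
  have hg0 : g 0 = 0 := by simp [hg]
  have hgk : g k = 0 := by simp [hg, hr.last]
  rw [Finset.sum_range_succ', hg0, hgk, add_zero, add_zero] at h3
  rw [h1, h2, ← h3]
  exact Finset.sum_congr rfl fun p _ => by simp [hg]

variable {r : ℕ → ℕ → ℂ}

/-- The middle term of the extension given by a shift system `r`, as a submodule of `A × I(ℓ)`,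
where `A` is `y ^ (-n) I(m)` for some large `n`. In degree `d` it consists of the pairs `(a, b)` for
which `a - ∑ b_p r_p` lies in the degree `d` part of `I(m)`. -/
def twisted (κI : Chart I (below ℓ.1)) (κJ : Chart J (below m.1))
    (hr : KSubset.IsShiftSystem ℓ m r) (n : ℕ) :
    Submodule (R k) ((J.shift (-n)).carrier × I.carrier) :=
  let S : AddSubgroup ((J.shift (-n)).carrier × I.carrier) :=
    { carrier := {z | ∀ d, ∀ j < below m.1 d,
        κJ.coeff ((J.shift (-n)).comp d z.1) j = mix k r (κI.coeff (I.comp d z.2)) j}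
      zero_mem' := fun d j _ => by
        rw [Prod.fst_zero, Prod.snd_zero, map_zero, map_zero, map_zero]
        erw [map_zero]
        rw [map_zero]
      add_mem' := fun {z w} hz hw d j hj => by
        rw [Prod.fst_add, Prod.snd_add, map_add, map_add, map_add, map_add, Pi.add_apply,
          ← hz d j hj, ← hw d j hj]
        erw [map_add]
        rfl
      neg_mem' := fun {z} hz d j hj => by
        rw [Prod.fst_neg, Prod.snd_neg, map_neg, map_neg, map_neg, map_neg, Pi.neg_apply,
          ← hz d j hj]
        erw [map_neg]
        rfl }
  { S with
    smul_mem' := by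
      refine smul_mem_of_generators S (fun c z hz d j hj => ?_) (fun z hz d j hj => ?_)
        (fun z hz d j hj => ?_)
      · rw [Prod.smul_fst, Prod.smul_snd, GrMod.comp_smul' (algebraMap_mem_piece c),
          GrMod.comp_smul' (algebraMap_mem_piece c), sub_zero, κI.coeff_scalar, map_smul,
          Pi.smul_apply, ← hz d j hj]
        erw [κJ.coeff_scalar]
        rfl
      · rw [Prod.smul_fst, Prod.smul_snd, GrMod.comp_smul' (xR_mem k), GrMod.comp_smul' (xR_mem k),
          κI.coeff_x, hr.mix_shift κI (GrMod.comp_mem _ _) (by rwa [sub_add_cancel])]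
        erw [κJ.coeff_x]
        rcases j with _ | j
        · rw [shift_zero, shift_zero]
        · have hjk := hj.trans_le (KSubset.below_le _)
          rw [shift_succ _ hjk, shift_succ _ hjk]
          refine hz (d - 1) j ?_
          have := below_le_add_one m.1 (d - 1)
          rw [sub_add_cancel] at this
          omega
      · rw [Prod.smul_fst, Prod.smul_snd, GrMod.comp_smul' (yR_mem k), GrMod.comp_smul' (yR_mem k),
          κI.coeff_y]
        erw [κJ.coeff_y]
        exact hz _ j (hj.trans_le (below_mono m.1 (by omega))) }

theorem comp_comp {M : GrMod.{u} k} (d e : ℤ) (z : M.carrier) :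
    M.comp e (M.comp d z) = if d = e then M.comp d z else 0 := by
  split_ifs with h
  · rw [← h, GrMod.comp_of_mem (GrMod.comp_mem d z)]
  · exact GrMod.comp_of_mem_ne (GrMod.comp_mem d z) h

theorem comp_mem_twisted (κI : Chart I (below ℓ.1)) (κJ : Chart J (below m.1))
    (hr : KSubset.IsShiftSystem ℓ m r) (n : ℕ) (z : (J.shift (-n)).carrier × I.carrier)
    (hz : z ∈ twisted κI κJ hr n) (d : ℤ) :
    ((J.shift (-n)).comp d z.1, I.comp d z.2) ∈ twisted κI κJ hr n := by
  intro e j hj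
  dsimp only
  rw [comp_comp, comp_comp]
  split_ifs with h
  · subst h
    exact hz _ j hj
  · rw [map_zero, map_zero]
    erw [map_zero]

/-- Multiplication by `y ^ n`, as a graded homomorphism `J → J(-n)`. -/
def yPowHom (J : GrMod.{u} k) (n : ℕ) : GrHom J (J.shift (-n)) where
  toLin := (yR k ^ n) • (LinearMap.id : J.carrier →ₗ[R k] J.carrier)
  map_deg hz := GrMod.y_pow_smul_mem n hz

/-- The extension of `I(ℓ)` by `I(m)` given by a shift system. -/
def twistedExtension (κI : Chart I (below ℓ.1)) (κJ : Chart J (below m.1))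
    (hr : KSubset.IsShiftSystem ℓ m r) (hr0 : ∀ p j, k ≤ j → r p j = 0) (n : ℕ)
    (hn : ∀ p < k, below m.1 (ℓ.nth p - n) = 0) : Extension I J where
  mid := GrMod.subProd (J.shift (-n)) I (twisted κI κJ hr n) (comp_mem_twisted κI κJ hr n)
  isMCM := by
    refine GrMod.isMCM_of_y_regular fun z hz => ?_
    have h1 : yR k • z.1 = 0 := congrArg Subtype.val hz
    refine Subtype.ext (Prod.ext ?_ ?_)
    · exact κJ.y_regular (congrArg Prod.fst h1)
    · exact κI.y_regular (congrArg Prod.snd h1)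
  inc :=
    { toLin := LinearMap.codRestrict (twisted κI κJ hr n)
        (LinearMap.inl (R k) (J.shift (-n)).carrier I.carrier ∘ₗ (yPowHom J n).toLin)
        fun z d j hj => by
          change κJ.coeff ((J.shift (-n)).comp d ((yPowHom J n).toLin z)) j =
            mix k r (κI.coeff (I.comp d 0)) j
          rw [← GrHom.comp_apply, map_zero, map_zero, map_zero]
          exact (congrFun (κJ.coeff_y_pow n _) j).trans
            (κJ.coeff_apply_eq_zero (GrMod.comp_mem d z) j (Or.inl hj))
      map_deg := fun hz => ⟨(yPowHom J n).map_deg hz, zero_mem _⟩ }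
  proj :=
    { toLin := LinearMap.snd (R k) (J.shift (-n)).carrier I.carrier ∘ₗ (twisted κI κJ hr n).subtype
      map_deg := fun hz => hz.2 }
  injective := by
    refine (injective_iff_map_eq_zero _).2 fun z hz => ?_
    exact GrMod.y_pow_regular (fun z => κJ.y_regular) n z
      (congrArg (fun w : twisted κI κJ hr n => (w : (J.shift (-n)).carrier × I.carrier).1) hz)
  exact := by
    rintro ⟨⟨a, b⟩, hab⟩
    constructor
    · intro hb
      have hb : b = 0 := hb
      subst hb
      have key : ∀ d, ∃ w ∈ J.deg d, (yPowHom J n).toLin w = (J.shift (-n)).comp d a := by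
        intro d
        have ha := GrMod.comp_mem (M := J.shift (-n)) d a
        obtain ⟨w, hw, hw'⟩ := κJ.exists_coeff_eq d (κJ.coeff ((J.shift (-n)).comp d a)) (by
          rintro j (hj | hj)
          · rw [hab d j hj]
            dsimp only
            rw [map_zero, map_zero, map_zero]
            rfl
          · exact κJ.coeff_eq_zero_of_le _ hj)
        exact ⟨w, hw, κJ.ext_of_mem ((yPowHom J n).map_deg hw) ha
          ((κJ.coeff_y_pow n w).trans hw')⟩
      choose w hw hwa using key
      obtain ⟨s, -, hs⟩ := GrMod.exists_eq_sum_comp (M := J.shift (-n)) a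
      refine ⟨∑ d ∈ s, w d, Subtype.ext (Prod.ext ?_ rfl)⟩
      change (yPowHom J n).toLin (∑ d ∈ s, w d) = a
      rw [map_sum, Finset.sum_congr rfl fun d _ => hwa d, ← hs]
    · rintro ⟨w, hw⟩
      rw [← hw]
      rfl
  surjective := by
    intro b
    change ∃ z : twisted κI κJ hr n, (z : (J.shift (-n)).carrier × I.carrier).2 = b
    induction b using GrMod.homogeneous_induction with
    | homogeneous d b hb =>
      obtain ⟨a, ha, hab⟩ := κJ.exists_coeff_eq (d + -n) (mix k r (κI.coeff b)) (by
        intro j hj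
        rw [mix_apply]
        refine Finset.sum_eq_zero fun p hp => ?_
        have hp := Finset.mem_range.1 hp
        rcases hj with hj | hj
        · rcases κI.coeff_eq_zero_or_le hb hp with h | h
          · rw [h, zero_mul]
          · have := below_mono m.1 (show d + -n ≤ ℓ.nth p - n by omega)
            have := hn p hp
            omega
        · rw [hr0 p j hj, mul_zero])
      have ha' : a ∈ (J.shift (-n)).deg d := ha
      refine ⟨⟨(a, b), fun e j hj => ?_⟩, rfl⟩
      dsimp only
      by_cases hde : d = e
      · subst hde
        rw [GrMod.comp_of_mem ha', GrMod.comp_of_mem hb, hab]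
      · rw [GrMod.comp_of_mem_ne ha' hde, GrMod.comp_of_mem_ne hb hde, map_zero, map_zero]
        exact congrFun (map_zero κJ.coeff) j
    | add z w hz hw =>
      obtain ⟨a, ha⟩ := hz
      obtain ⟨b, hb⟩ := hw
      exact ⟨a + b, by rw [Submodule.coe_add, Prod.snd_add, ha, hb]⟩

/-- A section of the extension given by a shift system makes that system trivial. -/
theorem isTrivialSystem_of_splits (κI : Chart I (below ℓ.1)) (κJ : Chart J (below m.1))
    (hr : KSubset.IsShiftSystem ℓ m r) (hr0 : ∀ p j, k ≤ j → r p j = 0) (n : ℕ)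
    (hn : ∀ p < k, below m.1 (ℓ.nth p - n) = 0)
    (h : (twistedExtension κI κJ hr hr0 n hn).Splits) : KSubset.IsTrivialSystem ℓ m r := by
  obtain ⟨s, hs⟩ := h
  let z : ℕ → twisted κI κJ hr n := fun p => s.toLin (κI.basis p)
  have hz2 : ∀ p, (z p : (J.shift (-n)).carrier × I.carrier).2 = κI.basis p := fun p =>
    LinearMap.congr_fun hs (κI.basis p)
  have hzmem : ∀ p < k, (z p : (J.shift (-n)).carrier × I.carrier).1 ∈
      (J.shift (-n)).deg (ℓ.nth p) := fun p hp => (s.map_deg (κI.basis_mem hp)).1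
  let a : ℕ → J.carrier := fun p => (z p : (J.shift (-n)).carrier × I.carrier).1
  have ha : ∀ p < k, xR k • a p = yR k ^ ℓ.gap p • a (p + 1) := by
    intro p hp
    have h1 := congrArg s.toLin (κI.x_smul_basis hp)
    rw [map_smul, map_smul] at h1
    exact congrArg (fun w : twisted κI κJ hr n => (w : (J.shift (-n)).carrier × I.carrier).1) h1
  have hcoeff : ∀ p < k, ∀ j < k,
      κJ.coeff (a p) j = if p ≤ j then κJ.coeff (a 0) (j - p) else 0 := by
    intro p
    induction p with
    | zero => exact fun _ j _ => by simp
    | succ p ih =>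
      intro hp j hj
      rw [← κJ.coeff_y_pow (ℓ.gap p), ← ha p (by omega), κJ.coeff_x]
      rcases j with _ | j
      · rw [shift_zero, if_neg (by omega)]
      · rw [shift_succ _ hj, ih (by omega) j (by omega), Nat.add_sub_add_right]
        exact if_congr (by omega) rfl rfl
  refine ⟨κJ.coeff (a 0), fun p hp j hj => ?_⟩
  rw [← hcoeff p hp j (hj.trans_le (KSubset.below_le _))]
  have h1 := (z p).2 (ℓ.nth p) j hj
  rw [GrMod.comp_of_mem (hzmem p hp), hz2, GrMod.comp_of_mem (κI.basis_mem hp), κI.coeff_basis hp,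
    mix_single r hp] at h1
  exact h1.symm

/-- Crossing `k`-subsets admit a nonsplit extension. -/
theorem exists_not_splits_of_cross (κI : Chart I (below ℓ.1)) (κJ : Chart J (below m.1))
    (h : Cross ℓ.1 m.1) : ∃ X : Extension I J, ¬ X.Splits := by
  obtain ⟨r, hr, hr0, hnt⟩ := KSubset.exists_isShiftSystem_of_cross h
  obtain ⟨e, -, he⟩ := exists_below_eq_zero m.1 0
  refine ⟨twistedExtension κI κJ hr hr0 (ℓ.nth (k - 1) - e).toNat fun p hp => ?_,
    fun hX => hnt (isTrivialSystem_of_splits κI κJ hr hr0 _ _ hX)⟩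
  have h1 : ℓ.nth p ≤ ℓ.nth (k - 1) := by
    rw [KSubset.le_nth_iff (by omega), KSubset.below_nth hp]
    omega
  have := below_mono m.1 (show ℓ.nth p - ((ℓ.nth (k - 1) - e).toNat : ℕ) ≤ e by omega)
  omega

theorem Extension.Splits.of_equivalent {X Y : Extension I J} (h : X.Equivalent Y)
    (hX : X.Splits) : Y.Splits := by
  obtain ⟨e, -, h2⟩ := h
  obtain ⟨s, hs⟩ := hX
  refine ⟨⟨e.toEquiv.toLinearMap ∘ₗ s.toLin, fun hz => e.map_deg_iff.2 (s.map_deg hz)⟩,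
    LinearMap.ext fun z => ?_⟩
  exact (h2 _).trans (LinearMap.congr_fun hs z)

theorem ext1Vanishes_iff : Ext1Vanishes I J ↔ ∀ X : Extension I J, X.Splits := by
  constructor
  · intro h X
    obtain ⟨Y, hY, hYX⟩ := h (Quotient.mk _ X)
    exact hY.of_equivalent (Quotient.exact hYX)
  · intro h c
    induction c using Quotient.inductionOn with
    | _ X => exact ⟨X, h X, rfl⟩

theorem ext1Vanishes_iff_not_cross (κI : Chart I (below ℓ.1)) (κJ : Chart J (below m.1)) :
    Ext1Vanishes I J ↔ ¬ Cross ℓ.1 m.1 := by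
  rw [ext1Vanishes_iff]
  constructor
  · intro h hc
    obtain ⟨X, hX⟩ := exists_not_splits_of_cross κI κJ hc
    exact hX (h X)
  · exact fun h X => X.splits_of_not_cross κI κJ h

end Ext

end GrassmannianInf

end

open GrassmannianInf in
theorem theorem4p1 (k : ℕ) (hk : 2 ≤ k) (I J : GrMod.{u} k)
    (hI : I.IsMCM) (hI₁ : I.IsGenericallyFree 1)
    (hJ : J.IsMCM) (hJ₁ : J.IsGenericallyFree 1) :
    (∃! ℓ : KSubset k, Corresponds hk I ℓ) ∧
    (∃! m : KSubset k, Corresponds hk J m) ∧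
    ∀ ℓ m : KSubset k, Corresponds hk I ℓ → Corresponds hk J m →
      (Ext1Vanishes I J ↔ Compatible ℓ m) := by
  refine ⟨existsUnique_corresponds hk hI hI₁, existsUnique_corresponds hk hJ hJ₁,
    fun ℓ m hℓ hm => ?_⟩
  obtain ⟨κI⟩ := (corresponds_iff hk).1 hℓ
  obtain ⟨κJ⟩ := (corresponds_iff hk).1 hm
  exact ext1Vanishes_iff_not_cross κI κJ
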